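/- Notation. Let $H$ be a complex Hilbert space and let $M=(M_p)_{p\in\mathbb N}$ be a sequence of positive reals. Put $m_p:=M_p/p!$, $\mu_0:=1$, $\mu_p:=M_p/M_{p-1}$ for $p\ge1$, and $M^*_p:=p!/M_p$. The associated weight function of a positive sequence $N$ is $\omega_N(0):=0$, $\omega_N(t):=\sup_{p\in\mathbb N}\log(t^p/N_p)$ for $t>0$. For a positive weight $v$ on $[0,\infty)$ let $\mathcal H^\infty_v(\mathbb C,H)$ be the space of entire functions $f:\mathbb C\to H$ with $\|f\|_v:=\sup_{z\in\mathbb C}\|f(z)\|\,v(|z|)<\infty$, normed by $\|\cdot\|_v$. With $v(t):=e^{-\omega_{M^*}(t)}$ define the locally convex inductive limits $$\mathcal H^\infty_{\underline{\mathcal M^*}_{\mathfrak c}}(\mathbb C,H):=\varinjlim_{c\in\mathbb N_{>0}}\mathcal H^\infty_{v(c\,\cdot)}(\mathbb C,H),\qquad \mathcal H^\infty_{\underline{\mathcal M^*}^{\mathfrak c}}(\mathbb C,H):=\varinjlim_{c\in\mathbb N_{>0}}\mathcal H^\infty_{v^c}(\mathbb C,H)$$ and the projective limits $$\mathcal H^\infty_{\overline{\mathcal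 M^*}_{\mathfrak c}}(\mathbb C,H):=\varprojlim_{c\in\mathbb N_{>0}}\mathcal H^\infty_{v(\cdot/c)}(\mathbb C,H),\qquad \mathcal H^\infty_{\overline{\mathcal M^*}^{\mathfrak c}}(\mathbb C,H):=\varprojlim_{c\in\mathbb N_{>0}}\mathcal H^\infty_{v^{1/c}}(\mathbb C,H).$$ Let $I\subseteq\mathbb R$ be a nondegenerate interval (open or not; derivatives at endpoints belonging to $I$ are one-sided). For smooth $f:I\to H$, compact $K\subseteq I$ and $h>0$ put $\|f\|_{M,K,h}:=\sup_{p\in\mathbb N,\,x\in K}\|f^{(p)}(x)\|/(h^pM_p)$. The Roumieu class $\mathcal E_{\{M\}}(I,H)$ consists of all smooth $f$ such that for every compact $K\subseteq I$ there is $h>0$ with $\|f\|_{M,K,h}<\infty$; the Beurling class $\mathcal E_{(M)}(I,H)$ of all smooth $f$ with $\|f\|_{M,K,h}<\infty$ for all compact $K\subseteq I$ and all $h>0$. They carry the topologies $\varprojlim_K\varinjlim_{h>0}\mathcal E_{M,h}(K,H)$ and $\varprojlim_K\varprojlim_{h>0}\mathcal E_{M,h}(K,H)$ respectively, where $K$ runs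 over the nondegenerate compact intervals contained in $I$, $\mathcal E_{M,h}(K,H):=\{f\in C^\infty(K,H):\|f\|_{M,K,h}<\infty\}$ is normed by $\|\cdot\|_{M,K,h}$, and inductive limits are taken in the category of locally convex spaces. Statement. Assume that * $M$ is log-convex, i.e. $M_p^2\le M_{p-1}M_{p+1}$ for all $p\ge1$, and $M_0=M_1=1$; * $\lim_{p\to\infty}(m_p)^{1/p}=0$; * $m$ is log-concave, i.e. $m_p^2\ge m_{p-1}m_{p+1}$ for all $p\ge1$; * for some integer $Q\ge2$ we have $\liminf_{p\to\infty}\mu_p/\mu_{Qp}>1/Q$. Then $$\mathcal H^\infty_{\underline{\mathcal M^*}_{\mathfrak c}}(\mathbb C,H)=\mathcal H^\infty_{\underline{\mathcal M^*}^{\mathfrak c}}(\mathbb C,H),\qquad \mathcal H^\infty_{\overline{\mathcal M^*}_{\mathfrak c}}(\mathbb C,H)=\mathcal H^\infty_{\overline{\mathcal M^*}^{\mathfrak c}}(\mathbb C,H)$$ as locally convex spaces (the same functions and the same topology). Moreover, for every nondegenerate interval $I\subseteq\mathbb R$ and every $x_0\in I$, the map $$f\mapsto E(f),\qquad E(f)(z):=\sum_{k=0}^\infty\frac{f^{(k)}(x_0)}{k!}(z-x_0)^k,$$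 where the series converges for every $z\in\mathbb C$, is an isomorphism of locally convex spaces from $\mathcal E_{\{M\}}(I,H)$ onto $\mathcal H^\infty_{\underline{\mathcal M^*}^{\mathfrak c}}(\mathbb C,H)$ and from $\mathcal E_{(M)}(I,H)$ onto $\mathcal H^\infty_{\overline{\mathcal M^*}^{\mathfrak c}}(\mathbb C,H)$. -/

import Mathlib

open Filter Topology
open scoped ContDiff Nat

noncomputable section

namespace UltraEntire

/-! ### Weight sequences -/

/-- The sequence `m_p = M_p / p!`. -/
def reduced (M : ℕ → ℝ) (p : ℕ) : ℝ := M p / (p ! : ℝ)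

/-- The quotients `μ_0 = 1`, `μ_p = M_p / M_{p-1}` for `p ≥ 1`. -/
def quotients (M : ℕ → ℝ) : ℕ → ℝ
  | 0 => 1
  | p + 1 => M (p + 1) / M p

/-- `M_p ^ 2 ≤ M_{p-1} M_{p+1}` for all `p ≥ 1`. -/
def LogConvex (M : ℕ → ℝ) : Prop := ∀ p : ℕ, M (p + 1) ^ 2 ≤ M p * M (p + 2)

/-- `M_p ^ 2 ≥ M_{p-1} M_{p+1}` for all `p ≥ 1`. -/
def LogConcave (M : ℕ → ℝ) : Prop := ∀ p : ℕ, M p * M (p + 2) ≤ M (p + 1) ^ 2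

/-- The conjugate sequence `M*_p = p! / M_p`. -/
def conjugate (M : ℕ → ℝ) (p : ℕ) : ℝ := (p ! : ℝ) / M p

/-- The associated weight function `ω_M(t) = sup_p log (t ^ p / M_p)` for `t > 0`, `ω_M(0) = 0`.
The supremum is finite as soon as `M_p ^ (1/p) → ∞`, see `bddAbove_assoWeight`. -/
def assoWeight (M : ℕ → ℝ) (t : ℝ) : ℝ :=
  if t = 0 then 0 else ⨆ p : ℕ, Real.log (t ^ p / M p)

theorem bddAbove_assoWeight {M : ℕ → ℝ} (hM : ∀ p, 0 < M p)
    (h : Tendsto (fun p : ℕ => M p ^ (1 / (p : ℝ))) atTop atTop) {t : ℝ} (ht : 0 < t) :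
    BddAbove (Set.range fun p : ℕ => Real.log (t ^ p / M p)) := by
  refine Filter.IsBoundedUnder.bddAbove_range (f := fun p : ℕ => Real.log (t ^ p / M p)) ?_
  refine Filter.isBoundedUnder_of_eventually_le (a := 0) ?_
  filter_upwards [h.eventually_ge_atTop t, eventually_ge_atTop 1] with p hp hp1
  have hp0 : (p : ℝ) ≠ 0 := by positivity
  refine Real.log_nonpos (div_nonneg (by positivity) (hM p).le) ?_
  rw [div_le_one (hM p)]
  calc t ^ p ≤ (M p ^ (1 / (p : ℝ))) ^ p := pow_le_pow_left₀ ht.le hp p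
    _ = M p := by
      rw [← Real.rpow_natCast, ← Real.rpow_mul (hM p).le, one_div_mul_cancel hp0, Real.rpow_one]

/-- The weight `v_M(t) = exp (-ω_M(t))`. -/
def weight (M : ℕ → ℝ) (t : ℝ) : ℝ := Real.exp (-assoWeight M t)

/-- The dilated weight `v_c(t) = v(c t)`. -/
def dilate (v : ℝ → ℝ) (c : ℝ) (t : ℝ) : ℝ := v (c * t)

/-- The powered weight `v^c(t) = v(t) ^ c`. -/
def power (v : ℝ → ℝ) (c : ℝ) (t : ℝ) : ℝ := v t ^ c

/-! ### Spaces given by sup-norms and their inductive and projective limits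

For linear maps `T_i : V → H` we consider `{f ∈ V : sup_i ‖T_i f‖ < ∞}` with norm
`f ↦ sup_i ‖T_i f‖`, and for a family of such norms the locally convex inductive limit and
the projective limit of these spaces. -/

section Limits

variable {V H ι κ : Type*} [AddCommGroup V] [Module ℂ V] [NormedAddCommGroup H] [NormedSpace ℂ H]

/-- The subspace of all `f` with `sup_i ‖T_i f‖ < ∞`. -/
def supSubmodule (T : ι → V →ₗ[ℂ] H) : Submodule ℂ V where
  carrier := {f | BddAbove (Set.range fun i => ‖T i f‖)}
  zero_mem' := ⟨0, by rintro _ ⟨i, rfl⟩; simp⟩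
  add_mem' := by
    rintro f g ⟨A, hA⟩ ⟨B, hB⟩
    refine ⟨A + B, ?_⟩
    rintro _ ⟨i, rfl⟩
    simp only [map_add]
    exact (norm_add_le _ _).trans (add_le_add (hA ⟨i, rfl⟩) (hB ⟨i, rfl⟩))
  smul_mem' := by
    rintro c f ⟨A, hA⟩
    refine ⟨‖c‖ * A, ?_⟩
    rintro _ ⟨i, rfl⟩
    simp only [map_smul, norm_smul]
    exact mul_le_mul_of_nonneg_left (hA ⟨i, rfl⟩) (norm_nonneg c)

/-- The norm `f ↦ sup_i ‖T_i f‖`. -/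
def supSeminorm (T : ι → V →ₗ[ℂ] H) : Seminorm ℂ (supSubmodule T) :=
  Seminorm.of (fun f => ⨆ i, ‖T i f.1‖)
    (by
      intro f g
      have hf : 0 ≤ ⨆ i, ‖T i f.1‖ := Real.iSup_nonneg fun i => norm_nonneg _
      have hg : 0 ≤ ⨆ i, ‖T i g.1‖ := Real.iSup_nonneg fun i => norm_nonneg _
      refine Real.iSup_le (fun i => ?_) (add_nonneg hf hg)
      simp only [Submodule.coe_add, map_add]
      exact (norm_add_le _ _).trans (add_le_add (le_ciSup f.2 i) (le_ciSup g.2 i)))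
    (by
      intro c f
      simp only [Submodule.coe_smul, map_smul, norm_smul]
      exact (Real.mul_iSup_of_nonneg (norm_nonneg c) _).symm)

/-- The space `{f ∈ V : sup_i ‖T_i f‖ < ∞}`, with the norm `sup_i ‖T_i f‖`. -/
def SupSpace (T : ι → V →ₗ[ℂ] H) : Type _ := ↥(supSubmodule T)

instance (T : ι → V →ₗ[ℂ] H) : SeminormedAddCommGroup (SupSpace T) :=
  AddGroupSeminorm.toSeminormedAddCommGroup (E := ↥(supSubmodule T))
    (supSeminorm T).toAddGroupSeminorm

instance (T : ι → V →ₗ[ℂ] H) : Module ℂ (SupSpace T) :=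
  inferInstanceAs (Module ℂ ↥(supSubmodule T))

/-- The underlying vector space of the inductive limit over `n` of the spaces `SupSpace (T n)`: the
sum of these subspaces of `V`, which is their union if they form a directed family,
see `mem_indSubmodule`. -/
def indSubmodule (T : κ → ι → V →ₗ[ℂ] H) : Submodule ℂ V := ⨆ n, supSubmodule (T n)

theorem mem_indSubmodule [Nonempty κ] {T : κ → ι → V →ₗ[ℂ] H}
    (hT : Directed (· ≤ ·) fun n => supSubmodule (T n)) {f : V} :
    f ∈ indSubmodule T ↔ ∃ n, f ∈ supSubmodule (T n) :=
  Submodule.mem_iSup_of_directed _ hT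

/-- The (locally convex) inductive limit of the spaces `SupSpace (T n)`. -/
def IndLim (T : κ → ι → V →ₗ[ℂ] H) : Type _ := ↥(indSubmodule T)

instance (T : κ → ι → V →ₗ[ℂ] H) : AddCommGroup (IndLim T) :=
  inferInstanceAs (AddCommGroup ↥(indSubmodule T))

instance (T : κ → ι → V →ₗ[ℂ] H) : Module ℂ (IndLim T) :=
  inferInstanceAs (Module ℂ ↥(indSubmodule T))

/-- The element of `V` underlying an element of the inductive limit. -/
def IndLim.val {T : κ → ι → V →ₗ[ℂ] H} : IndLim T →ₗ[ℂ] V := (indSubmodule T).subtype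

/-- The inclusion of the `n`-th space into the inductive limit. -/
def IndLim.incl (T : κ → ι → V →ₗ[ℂ] H) (n : κ) (f : SupSpace (T n)) : IndLim T :=
  ⟨f.1, (le_iSup (fun n => supSubmodule (T n)) n) f.2⟩

/-- The finest locally convex vector space topology for which the inclusions of all
`SupSpace (T n)` are continuous. -/
instance (T : κ → ι → V →ₗ[ℂ] H) : TopologicalSpace (IndLim T) :=
  sInf {t | @IsTopologicalAddGroup (IndLim T) t _ ∧ @ContinuousSMul ℂ (IndLim T) _ _ t ∧
    @LocallyConvexSpace ℝ (IndLim T) _ _ _ _ t ∧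
    ∀ n, @Continuous (SupSpace (T n)) (IndLim T) _ t (IndLim.incl T n)}

/-- The underlying vector space of the projective limit over `n` of the spaces `SupSpace (T n)`. -/
def projSubmodule (T : κ → ι → V →ₗ[ℂ] H) : Submodule ℂ V := ⨅ n, supSubmodule (T n)

/-- The projective limit (intersection) of the spaces `SupSpace (T n)`. -/
def ProjLim (T : κ → ι → V →ₗ[ℂ] H) : Type _ := ↥(projSubmodule T)

instance (T : κ → ι → V →ₗ[ℂ] H) : AddCommGroup (ProjLim T) :=
  inferInstanceAs (AddCommGroup ↥(projSubmodule T))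

instance (T : κ → ι → V →ₗ[ℂ] H) : Module ℂ (ProjLim T) :=
  inferInstanceAs (Module ℂ ↥(projSubmodule T))

/-- The element of `V` underlying an element of the projective limit. -/
def ProjLim.val {T : κ → ι → V →ₗ[ℂ] H} : ProjLim T →ₗ[ℂ] V := (projSubmodule T).subtype

/-- The inclusion of the projective limit into the `n`-th space. -/
def ProjLim.proj (T : κ → ι → V →ₗ[ℂ] H) (n : κ) (f : ProjLim T) : SupSpace (T n) :=
  ⟨f.1, (iInf_le (fun n => supSubmodule (T n)) n) f.2⟩

/-- The coarsest topology for which the inclusions into all `SupSpace (T n)` are continuous. -/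
instance (T : κ → ι → V →ₗ[ℂ] H) : TopologicalSpace (ProjLim T) :=
  ⨅ n, TopologicalSpace.induced (ProjLim.proj T n) inferInstance

end Limits

/-! ### Weighted spaces of entire functions -/

section Entire

variable (H : Type*) [NormedAddCommGroup H] [NormedSpace ℂ H]

/-- The space of entire functions with values in `H`. -/
def Entire : Submodule ℂ (ℂ → H) where
  carrier := {f | Differentiable ℂ f}
  zero_mem' := differentiable_const 0
  add_mem' := fun hf hg => Differentiable.add hf hg
  smul_mem' := fun c _ hf => Differentiable.const_smul hf c

variable {H} in
/-- The linear maps `f ↦ v(|z|) f(z)`, `z ∈ ℂ`, so that `‖f‖_v = sup_z ‖f(z)‖ v(|z|)`. -/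
def weightedEval (v : ℝ → ℝ) (z : ℂ) : Entire H →ₗ[ℂ] H where
  toFun f := (v ‖z‖ : ℂ) • f.1 z
  map_add' _ _ := smul_add _ _ _
  map_smul' _ _ := smul_comm _ _ _

/-- The inductive limit over `n ≥ 1` of the weighted spaces of entire functions for the
weights `v_n`. -/
abbrev HolInd (v : ℕ+ → ℝ → ℝ) : Type _ :=
  IndLim (fun n : ℕ+ => weightedEval (H := H) (v n))

/-- The projective limit over `n ≥ 1` of the weighted spaces of entire functions for the
weights `v_n`. -/
abbrev HolProj (v : ℕ+ → ℝ → ℝ) : Type _ :=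
  ProjLim (fun n : ℕ+ => weightedEval (H := H) (v n))

end Entire

/-! ### Ultradifferentiable classes on intervals -/

/-- A nondegenerate interval of the real line (open, closed, half-open, bounded or not). -/
structure NondegInterval where
  carrier : Set ℝ
  ordConnected : carrier.OrdConnected
  nontrivial : carrier.Nontrivial

theorem NondegInterval.uniqueDiffOn (S : NondegInterval) : UniqueDiffOn ℝ S.carrier := by
  refine uniqueDiffOn_convex S.ordConnected.convex ?_
  obtain ⟨a, ha, b, hb, hab⟩ := S.nontrivial.exists_lt
  obtain ⟨c, hc⟩ := exists_between hab
  exact ⟨c, interior_maximal (Set.Ioo_subset_Icc_self.trans (S.ordConnected.out ha hb))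
    isOpen_Ioo hc⟩

/-- A compact nondegenerate interval contained in `I`. -/
structure CompactSubinterval (I : NondegInterval) extends NondegInterval where
  isCompact : IsCompact carrier
  subset : carrier ⊆ I.carrier

section Ultra

set_option linter.unusedSectionVars false

variable {H : Type*} [NormedAddCommGroup H] [NormedSpace ℂ H]

open Classical in
/-- Extension by zero of a function on an interval. It is only used to speak about derivatives
within the interval, which do not depend on the values outside. -/
def zeroExt (S : NondegInterval) (f : S.carrier → H) (x : ℝ) : H :=
  if hx : x ∈ S.carrier then f ⟨x, hx⟩ else 0

theorem zeroExt_add (S : NondegInterval) (f g : S.carrier → H) :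
    zeroExt S (f + g) = zeroExt S f + zeroExt S g := by
  funext x
  by_cases hx : x ∈ S.carrier <;> simp [zeroExt, hx]

theorem zeroExt_smul (S : NondegInterval) (c : ℂ) (f : S.carrier → H) :
    zeroExt S (c • f) = c • zeroExt S f := by
  funext x
  by_cases hx : x ∈ S.carrier <;> simp [zeroExt, hx]

variable (H) in
/-- The space of smooth functions on an interval with values in `H` (with one-sided derivatives at
endpoints that belong to the interval). -/
def Smooth (S : NondegInterval) : Submodule ℂ (S.carrier → H) where
  carrier := {f | ContDiffOn ℝ ∞ (zeroExt S f) S.carrier}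
  zero_mem' := by
    have h : zeroExt S (0 : S.carrier → H) = fun _ => 0 := by
      funext x
      simp [zeroExt]
    simpa only [Set.mem_ofPred_eq, h] using contDiffOn_const
  add_mem' := fun {f g} hf hg => by
    simp only [Set.mem_ofPred_eq, zeroExt_add] at *
    exact hf.add hg
  smul_mem' := fun c f hf => by
    simp only [Set.mem_ofPred_eq, zeroExt_smul] at *
    exact hf.const_smul c

/-- The map `f ↦ f^{(p)}(x)` on smooth functions on an interval. -/
def derivAt (S : NondegInterval) (p : ℕ) (x : S.carrier) : Smooth H S →ₗ[ℂ] H where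
  toFun f := iteratedDerivWithin p (zeroExt S f.1) S.carrier x
  map_add' f g := by
    have hf : ContDiffOn ℝ ∞ (zeroExt S f.1) S.carrier := f.2
    have hg : ContDiffOn ℝ ∞ (zeroExt S g.1) S.carrier := g.2
    rw [Submodule.coe_add, zeroExt_add]
    exact iteratedDerivWithin_add x.2 S.uniqueDiffOn
      ((hf x x.2).of_le (by exact_mod_cast le_top)) ((hg x x.2).of_le (by exact_mod_cast le_top))
  map_smul' c f := by
    have hf : ContDiffOn ℝ ∞ (zeroExt S f.1) S.carrier := f.2
    rw [Submodule.coe_smul, zeroExt_smul]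
    exact iteratedDerivWithin_const_smul x.2 S.uniqueDiffOn c
      ((hf x x.2).of_le (by exact_mod_cast le_top))

/-- The linear maps `f ↦ f^{(p)}(x) / (h^p M_p)` for `p ∈ ℕ` and `x ∈ K`, so that
`‖f‖_{M,K,h} = sup_{p, x} ‖f^{(p)}(x)‖ / (h^p M_p)`. -/
def ultraEval (M : ℕ → ℝ) (S : NondegInterval) (K : Set ℝ) (h : ℝ)
    (i : ℕ × {x : S.carrier // (x : ℝ) ∈ K}) : Smooth H S →ₗ[ℂ] H :=
  (((h ^ i.1 * M i.1)⁻¹ : ℝ) : ℂ) • derivAt S i.1 i.2.1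

variable (H) in
/-- The space `E_{M}(K)` for a compact interval `K`: inductive limit over `h > 0`. -/
abbrev RoumieuCompact (M : ℕ → ℝ) (K : NondegInterval) : Type _ :=
  IndLim (fun h : {h : ℝ // 0 < h} => ultraEval (H := H) M K K.carrier h)

variable (H) in
/-- The space `E_(M)(K)` for a compact interval `K`: projective limit over `h > 0`. -/
abbrev BeurlingCompact (M : ℕ → ℝ) (K : NondegInterval) : Type _ :=
  ProjLim (fun h : {h : ℝ // 0 < h} => ultraEval (H := H) M K K.carrier h)

theorem supSubmodule_ultraEval_mono (M : ℕ → ℝ) (S : NondegInterval) (K : Set ℝ) :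
    Monotone fun h : {h : ℝ // 0 < h} => supSubmodule (ultraEval (H := H) M S K h) := by
  rintro ⟨h, hh⟩ ⟨h', hh'⟩ hle f ⟨A, hA⟩
  refine ⟨A, ?_⟩
  rintro _ ⟨i, rfl⟩
  refine le_trans ?_ (hA ⟨i, rfl⟩)
  have hle' : h ≤ h' := hle
  simp only [ultraEval, LinearMap.smul_apply, norm_smul, Complex.norm_real, norm_inv, norm_mul,
    norm_pow, Real.norm_eq_abs, abs_of_pos hh, abs_of_pos hh', mul_inv]
  gcongr

variable (H) in
/-- The Roumieu class `E_{M}(I)`: all smooth `f` such that for every compact `K ⊆ I` there is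
`h > 0` with `‖f‖_{M,K,h} < ∞`. -/
def roumieuSubmodule (M : ℕ → ℝ) (I : NondegInterval) : Submodule ℂ (Smooth H I) where
  carrier := {f | ∀ K : Set ℝ, IsCompact K → K ⊆ I.carrier →
    ∃ h : {h : ℝ // 0 < h}, f ∈ supSubmodule (ultraEval M I K h)}
  zero_mem' := fun _ _ _ => ⟨⟨1, one_pos⟩, Submodule.zero_mem _⟩
  add_mem' := fun hf hg K hK hKI => by
    obtain ⟨h, h1⟩ := hf K hK hKI
    obtain ⟨k, h2⟩ := hg K hK hKI
    exact ⟨max h k, Submodule.add_mem _ (supSubmodule_ultraEval_mono M I K (le_max_left h k) h1)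
      (supSubmodule_ultraEval_mono M I K (le_max_right h k) h2)⟩
  smul_mem' := fun c f hf K hK hKI => by
    obtain ⟨h, h1⟩ := hf K hK hKI
    exact ⟨h, Submodule.smul_mem _ c h1⟩

variable (H) in
/-- The Beurling class `E_(M)(I)`: all smooth `f` such that `‖f‖_{M,K,h} < ∞` for every compact
`K ⊆ I` and every `h > 0`. -/
def beurlingSubmodule (M : ℕ → ℝ) (I : NondegInterval) : Submodule ℂ (Smooth H I) where
  carrier := {f | ∀ K : Set ℝ, IsCompact K → K ⊆ I.carrier →
    ∀ h : {h : ℝ // 0 < h}, f ∈ supSubmodule (ultraEval M I K h)}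
  zero_mem' := fun K _ _ h => Submodule.zero_mem _
  add_mem' := fun {f g} hf hg K hK hKI h => by
    have h1 : f ∈ supSubmodule (ultraEval M I K h) := hf K hK hKI h
    have h2 : g ∈ supSubmodule (ultraEval M I K h) := hg K hK hKI h
    exact Submodule.add_mem _ h1 h2
  smul_mem' := fun c f hf K hK hKI h => by
    have h1 : f ∈ supSubmodule (ultraEval M I K h) := hf K hK hKI h
    exact Submodule.smul_mem _ c h1

theorem zeroExt_restrict_eqOn {I : NondegInterval} (K : CompactSubinterval I)
    (f : I.carrier → H) :
    Set.EqOn (zeroExt K.toNondegInterval fun x => f ⟨x.1, K.subset x.2⟩) (zeroExt I f)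
      K.carrier := by
  intro x hx
  simp [zeroExt, hx, K.subset hx]

/-- Restriction of smooth functions on `I` to a compact subinterval `K`. -/
def restrict {I : NondegInterval} (K : CompactSubinterval I) (f : Smooth H I) :
    Smooth H K.toNondegInterval :=
  ⟨fun x => f.1 ⟨x.1, K.subset x.2⟩, by
    have hf : ContDiffOn ℝ ∞ (zeroExt I f.1) I.carrier := f.2
    exact (hf.mono K.subset).congr (zeroExt_restrict_eqOn K f.1)⟩

theorem derivAt_restrict {I : NondegInterval} (K : CompactSubinterval I) (f : Smooth H I)
    (p : ℕ) (x : K.carrier) :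
    derivAt K.toNondegInterval p x (restrict K f) = derivAt I p ⟨x.1, K.subset x.2⟩ f := by
  have hf : ContDiffOn ℝ ∞ (zeroExt I f.1) I.carrier := f.2
  change iteratedDerivWithin p (zeroExt K.toNondegInterval _) K.carrier x.1 =
    iteratedDerivWithin p (zeroExt I f.1) I.carrier x.1
  have hc := iteratedDerivWithin_congr (n := p) (zeroExt_restrict_eqOn K f.1) x.2
  refine hc.trans ?_
  simp only [iteratedDerivWithin]
  rw [iteratedFDerivWithin_subset K.subset K.uniqueDiffOn I.uniqueDiffOn
    (hf.of_le (by exact_mod_cast le_top)) x.2]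

theorem restrict_mem {M : ℕ → ℝ} {I : NondegInterval} (K : CompactSubinterval I) {f : Smooth H I}
    {h : ℝ} (hf : f ∈ supSubmodule (ultraEval M I K.carrier h)) :
    restrict K f ∈ supSubmodule (ultraEval M K.toNondegInterval K.carrier h) := by
  obtain ⟨A, hA⟩ := hf
  refine ⟨A, ?_⟩
  rintro _ ⟨⟨p, x⟩, rfl⟩
  have := hA ⟨⟨p, ⟨⟨x.1.1, K.subset x.1.2⟩, x.2⟩⟩, rfl⟩
  simpa only [ultraEval, LinearMap.smul_apply, derivAt_restrict] using this

variable (H) in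
/-- The Roumieu class `E_{M}(I)` as a locally convex space. -/
def Roumieu (M : ℕ → ℝ) (I : NondegInterval) : Type _ := ↥(roumieuSubmodule H M I)

instance (M : ℕ → ℝ) (I : NondegInterval) : AddCommGroup (Roumieu H M I) :=
  inferInstanceAs (AddCommGroup ↥(roumieuSubmodule H M I))

instance (M : ℕ → ℝ) (I : NondegInterval) : Module ℂ (Roumieu H M I) :=
  inferInstanceAs (Module ℂ ↥(roumieuSubmodule H M I))

/-- The smooth function underlying an element of `E_{M}(I)`. -/
def Roumieu.val {M : ℕ → ℝ} {I : NondegInterval} : Roumieu H M I →ₗ[ℂ] Smooth H I :=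
  (roumieuSubmodule H M I).subtype

/-- The restriction map `E_{M}(I) → E_{M}(K)`. -/
def Roumieu.restrict {M : ℕ → ℝ} {I : NondegInterval} (K : CompactSubinterval I)
    (f : Roumieu H M I) : RoumieuCompact H M K.toNondegInterval :=
  ⟨UltraEntire.restrict K f.1, by
    obtain ⟨h, hf⟩ := f.2 K.carrier K.isCompact K.subset
    exact Submodule.mem_iSup_of_mem h (restrict_mem K hf)⟩

/-- The projective limit topology with respect to the restrictions to compact subintervals. -/
instance (M : ℕ → ℝ) (I : NondegInterval) : TopologicalSpace (Roumieu H M I) :=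
  ⨅ K : CompactSubinterval I, TopologicalSpace.induced (Roumieu.restrict K) inferInstance

variable (H) in
/-- The Beurling class `E_(M)(I)` as a locally convex space. -/
def Beurling (M : ℕ → ℝ) (I : NondegInterval) : Type _ := ↥(beurlingSubmodule H M I)

instance (M : ℕ → ℝ) (I : NondegInterval) : AddCommGroup (Beurling H M I) :=
  inferInstanceAs (AddCommGroup ↥(beurlingSubmodule H M I))

instance (M : ℕ → ℝ) (I : NondegInterval) : Module ℂ (Beurling H M I) :=
  inferInstanceAs (Module ℂ ↥(beurlingSubmodule H M I))

/-- The smooth function underlying an element of `E_(M)(I)`. -/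
def Beurling.val {M : ℕ → ℝ} {I : NondegInterval} : Beurling H M I →ₗ[ℂ] Smooth H I :=
  (beurlingSubmodule H M I).subtype

/-- The restriction map `E_(M)(I) → E_(M)(K)`. -/
def Beurling.restrict {M : ℕ → ℝ} {I : NondegInterval} (K : CompactSubinterval I)
    (f : Beurling H M I) : BeurlingCompact H M K.toNondegInterval :=
  ⟨UltraEntire.restrict K f.1, (Submodule.mem_iInf _).2 fun h =>
    restrict_mem K (f.2 K.carrier K.isCompact K.subset h)⟩

/-- The projective limit topology with respect to the restrictions to compact subintervals. -/
instance (M : ℕ → ℝ) (I : NondegInterval) : TopologicalSpace (Beurling H M I) :=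
  ⨅ K : CompactSubinterval I, TopologicalSpace.induced (Beurling.restrict K) inferInstance

/-- `F` is the sum `E(f)` of the Taylor series of `f` at `x₀`:
`F(z) = ∑_k f^{(k)}(x₀) / k! (z - x₀)^k` for all `z`, with convergence. -/
def IsTaylorExtension {I : NondegInterval} (x₀ : I.carrier) (f : Smooth H I) (F : Entire H) :
    Prop :=
  ∀ z : ℂ, HasSum (fun k : ℕ => ((z - ((x₀ : ℝ) : ℂ)) ^ k / (k ! : ℂ)) • derivAt I k x₀ f) (F.1 z)

end Ultra

end UltraEntire

end

open UltraEntire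

/-! Put `N = M*`, so that `M_k / k! = 1 / N_k`. Log-concavity of `m` and `m_p^(1/p) → 0` say that
`N` is log-convex with `N_p^(1/p) → ∞`. Write `ω` for its weight function and `ν_p = N_p / N_{p-1}`
for its increasing quotients.

Dilating and taking powers of `exp (-ω)` are interchangeable, by two inequalities. Log-convexity of
`M` gives `M_p^2 ≤ M_{2p}`, hence `N_{2p} ≤ 4^p N_p^2` and `2 ω(t) ≤ ω(2t)`; iteration bounds every
multiple of `ω` by a dilation (`exists_mul_weight_le`). Since `ν_p = p / μ_p`, the liminf condition
says that eventually `ν_{Qp} ≥ q ν_p` for some `q > 1`, which yields `ω(qt) ≤ 3Q ω(t) + C`;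
iteration bounds every dilation by a multiple plus a constant (`exists_weight_mul_le`).

The Taylor isomorphism is proved for the dilated weights, by explicit estimates. If `‖f^{(k)}(x₀)‖ ≤
A h^k M_k`, the Taylor terms are at most `A (h|z - x₀|)^k / N_k`, so the series is entire with
growth `exp ω(4h|z|)` (`exists_entire_hasSum`). Conversely, growth `exp ω(c|z|)` and Cauchy's
estimate, on a circle where the supremum defining `ω` is attained at the index `p`, give `‖F^{(p)}‖
≤ C (2c)^p M_p` on compact sets (`norm_iteratedDeriv_le`). Taylor's remainder shows that `f` is the
restriction of its extension, so the two maps are mutually inverse. The constants depend linearly on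
the norms, so both maps are continuous without an open mapping theorem. -/

namespace UltraEntire

/-! ### The associated weight function of a normalised log-convex sequence -/

/-- A log-convex sequence `N` of positive reals with `N_0 = N_1 = 1` and `N_p ^ (1/p) → ∞`. -/
structure IsNormalizedSeq (N : ℕ → ℝ) : Prop where
  pos : ∀ p, 0 < N p
  logConvex : LogConvex N
  zero : N 0 = 1
  one : N 1 = 1
  tendsto : Tendsto (fun p : ℕ => N p ^ (1 / (p : ℝ))) atTop atTop

theorem LogConvex.ratio_mono {N : ℕ → ℝ} (hN : LogConvex N) (hpos : ∀ p, 0 < N p) :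
    Monotone fun k => N (k + 1) / N k := by
  refine monotone_nat_of_le_succ fun k => ?_
  rw [div_le_div_iff₀ (hpos _) (hpos _)]
  have := hN k
  nlinarith

namespace IsNormalizedSeq

variable {N : ℕ → ℝ} (hN : IsNormalizedSeq N)
include hN

theorem bddAbove {t : ℝ} (ht : 0 < t) :
    BddAbove (Set.range fun p : ℕ => Real.log (t ^ p / N p)) :=
  bddAbove_assoWeight hN.pos hN.tendsto ht

theorem ratio_mono : Monotone fun k => N (k + 1) / N k := hN.logConvex.ratio_mono hN.pos

theorem one_le_ratio (k : ℕ) : 1 ≤ N (k + 1) / N k := by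
  simpa [hN.zero, hN.one] using hN.ratio_mono (Nat.zero_le k)

theorem mono : Monotone N := by
  refine monotone_nat_of_le_succ fun k => ?_
  have := hN.one_le_ratio k
  rwa [one_le_div (hN.pos k)] at this

theorem pow_div_le {t : ℝ} (ht : 0 < t) (p : ℕ) : t ^ p / N p ≤ Real.exp (assoWeight N t) := by
  rw [← Real.log_le_iff_le_exp (div_pos (pow_pos ht p) (hN.pos p)), assoWeight, if_neg ht.ne']
  exact le_ciSup (hN.bddAbove ht) p

theorem pow_div_le' {t : ℝ} (ht : 0 ≤ t) (p : ℕ) : t ^ p / N p ≤ Real.exp (assoWeight N t) := by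
  rcases ht.eq_or_lt with rfl | ht
  · rcases p with _ | p
    · simp [hN.zero, assoWeight]
    · simp [assoWeight]
  · exact hN.pow_div_le ht p

omit hN in
theorem _root_.UltraEntire.assoWeight_le_of_forall {N : ℕ → ℝ} (hpos : ∀ p, 0 < N p) {t B : ℝ}
    (ht : 0 < t) (h : ∀ p, t ^ p / N p ≤ Real.exp B) : assoWeight N t ≤ B := by
  rw [assoWeight, if_neg ht.ne']
  exact ciSup_le fun p => (Real.log_le_iff_le_exp (div_pos (pow_pos ht p) (hpos p))).2 (h p)

theorem nonneg {t : ℝ} (ht : 0 ≤ t) : 0 ≤ assoWeight N t := by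
  have := hN.pow_div_le' ht 0
  rwa [pow_zero, hN.zero, div_one, Real.one_le_exp_iff] at this

theorem weight_mono {s t : ℝ} (hs : 0 ≤ s) (hst : s ≤ t) : assoWeight N s ≤ assoWeight N t := by
  rcases hs.eq_or_lt with rfl | hs
  · simpa [assoWeight] using hN.nonneg hst
  · refine assoWeight_le_of_forall hN.pos hs fun p => le_trans ?_ (hN.pow_div_le (hs.trans_le hst) p)
    have := hN.pos p
    gcongr

/-- Holds because `s + t ≤ 2 max(s, t)` and `ω ≥ 0`. It separates the contribution of a bounded
shift of the argument, at the price of doubling the dilation. -/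
theorem weight_add_le {s t : ℝ} (hs : 0 ≤ s) (ht : 0 ≤ t) :
    assoWeight N (s + t) ≤ assoWeight N (2 * s) + assoWeight N (2 * t) := by
  have h1 := hN.nonneg (mul_nonneg zero_le_two hs)
  have h2 := hN.nonneg (mul_nonneg zero_le_two ht)
  rcases le_total s t with h | h
  · linarith [hN.weight_mono (add_nonneg hs ht) (show s + t ≤ 2 * t by linarith)]
  · linarith [hN.weight_mono (add_nonneg hs ht) (show s + t ≤ 2 * s by linarith)]

/-- The supremum defining the weight function at `N_{k+1} / N_k` is attained at the index `k`. -/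
theorem exp_weight_ratio_le (k : ℕ) :
    Real.exp (assoWeight N (N (k + 1) / N k)) ≤ (N (k + 1) / N k) ^ k / N k := by
  set t := N (k + 1) / N k with ht
  have ht0 : 0 < t := div_pos (hN.pos _) (hN.pos _)
  have hpos : 0 < t ^ k / N k := div_pos (pow_pos ht0 k) (hN.pos k)
  rw [← Real.le_log_iff_exp_le hpos]
  refine assoWeight_le_of_forall hN.pos ht0 fun p => ?_
  rw [Real.exp_log hpos]
  -- Consecutive terms differ by the factor `t / ν_{j+1}` with `t = ν_{k+1}`: at least 1 for `j ≤
  -- k`, at most 1 for `j ≥ k`. So the terms rise up to index `k` and do not increase afterwards.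
  have step (j : ℕ) : t ^ (j + 1) / N (j + 1) = t ^ j / N j * (t / (N (j + 1) / N j)) := by
    have h1 := (hN.pos j).ne'
    have h2 := (hN.pos (j + 1)).ne'
    field_simp
    ring
  have hj (j : ℕ) : 0 < N (j + 1) / N j := div_pos (hN.pos _) (hN.pos _)
  have hj' (j : ℕ) : 0 < t ^ j / N j := div_pos (pow_pos ht0 j) (hN.pos _)
  rcases le_total k p with h | h
  · induction p, h using Nat.le_induction with
    | base => exact le_rfl
    | succ j hkj ih =>
      refine le_trans ?_ ih
      rw [step]
      refine mul_le_of_le_one_right (hj' j).le ?_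
      rw [div_le_one (hj j)]
      exact hN.ratio_mono hkj
  · induction h using Nat.decreasingInduction with
    | self => exact le_rfl
    | of_succ j hkj ih =>
      refine le_trans ?_ ih
      rw [step]
      refine le_mul_of_one_le_right (hj' j).le ?_
      rw [one_le_div (hj j)]
      exact hN.ratio_mono hkj.le

end IsNormalizedSeq

/-! ### Dilations and multiples of the weight function -/

/-- The square of the `p`-th term at `t` is at most the `2p`-th term at `2t`, whence `2 ω(t) ≤
ω(2t)`; this is then iterated. -/
theorem IsNormalizedSeq.two_pow_mul_weight_le {N : ℕ → ℝ} (hN : IsNormalizedSeq N)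
    (h : ∀ p, N (2 * p) ≤ 4 ^ p * N p ^ 2) (k : ℕ) {t : ℝ} (ht : 0 < t) :
    2 ^ k * assoWeight N t ≤ assoWeight N (2 ^ k * t) := by
  induction k with
  | zero => simp
  | succ k ih =>
    have key {s : ℝ} (hs : 0 < s) : 2 * assoWeight N s ≤ assoWeight N (2 * s) := by
      have : assoWeight N s ≤ assoWeight N (2 * s) / 2 := by
        refine assoWeight_le_of_forall hN.pos hs fun p => ?_
        refine (sq_le_sq₀ (div_pos (pow_pos hs p) (hN.pos p)).le (Real.exp_pos _).le).1 ?_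
        have e : Real.exp (assoWeight N (2 * s) / 2) ^ 2 = Real.exp (assoWeight N (2 * s)) := by
          rw [← Real.exp_nat_mul]
          congr 1
          push_cast
          ring
        rw [e]
        refine le_trans ?_ (hN.pow_div_le (by positivity) (2 * p))
        have h1 := hN.pos p
        have h2 := hN.pos (2 * p)
        rw [div_pow, div_le_div_iff₀ (by positivity) h2]
        calc (s ^ p) ^ 2 * N (2 * p) ≤ (s ^ p) ^ 2 * (4 ^ p * N p ^ 2) := by
              gcongr
              exact h p
          _ = (2 * s) ^ (2 * p) * N p ^ 2 := by
              rw [mul_pow, pow_mul 2 2 p]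
              norm_num
              ring
      linarith
    have := key (s := 2 ^ k * t) (by positivity)
    calc (2 : ℝ) ^ (k + 1) * assoWeight N t = 2 * (2 ^ k * assoWeight N t) := by ring
      _ ≤ 2 * assoWeight N (2 ^ k * t) := by linarith
      _ ≤ _ := this
      _ = _ := by
        congr 1
        ring

theorem IsNormalizedSeq.exists_mul_weight_le {N : ℕ → ℝ} (hN : IsNormalizedSeq N)
    (h : ∀ p, N (2 * p) ≤ 4 ^ p * N p ^ 2) (c : ℝ) :
    ∃ d : ℕ+, ∀ t, 0 ≤ t → c * assoWeight N t ≤ assoWeight N (d * t) := by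
  obtain ⟨k, hk⟩ := pow_unbounded_of_one_lt c (one_lt_two)
  refine ⟨⟨2 ^ k, by positivity⟩, fun t ht => ?_⟩
  rcases ht.eq_or_lt with rfl | ht
  · simp [assoWeight]
  · calc c * assoWeight N t ≤ 2 ^ k * assoWeight N t := by
          have := hN.nonneg ht.le
          gcongr
      _ ≤ _ := hN.two_pow_mul_weight_le h k ht
      _ = _ := by simp

theorem bddAbove_of_eventually_succ_le {u : ℕ → ℝ} (h : ∀ᶠ n in atTop, u (n + 1) ≤ u n) :
    BddAbove (Set.range u) := by
  obtain ⟨n, hn⟩ := eventually_atTop.1 h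
  refine Filter.IsBoundedUnder.bddAbove_range ⟨u n, ?_⟩
  refine eventually_map.2 (eventually_atTop.2 ⟨n, fun m hm => ?_⟩)
  induction m, hm using Nat.le_induction with
  | base => exact le_rfl
  | succ j hj ih => exact (hn j hj).trans ih

/-- The quotient of the two sides is eventually nonincreasing in `r`: the next step multiplies the
left by `(q ν_{r+1})^Q` and `N (Q * (r + 1))` by `Q` quotients, all at least `ν_{Q(r+1)} ≥ q
ν_{r+1}`. The shift to `Q * (r + 1)` places these quotients after `ν_{Q(r+1)}`, so that monotonicity
applies. -/
theorem IsNormalizedSeq.exists_pow_le {N : ℕ → ℝ} (hN : IsNormalizedSeq N) {Q : ℕ} {q : ℝ}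
    (hq : 1 < q)
    (h : ∀ᶠ p in atTop, q * (N (p + 1) / N p) ≤ N (Q * (p + 1)) / N (Q * (p + 1) - 1)) :
    ∃ C, ∀ r, q ^ (Q * (r + 1)) * N r ^ Q ≤ C * N (Q * (r + 1)) := by
  have hq0 : 0 < q := zero_lt_one.trans hq
  obtain ⟨C, hC⟩ := bddAbove_of_eventually_succ_le
    (u := fun r => q ^ (Q * (r + 1)) * N r ^ Q / N (Q * (r + 1))) (by
      filter_upwards [h] with r hr
      have h0 := hN.pos r
      have h1 := hN.pos (r + 1)
      have h2 := hN.pos (Q * (r + 1))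
      have h3 := hN.pos (Q * (r + 1 + 1))
      have key : ∀ l : ℕ, (N (Q * (r + 1)) / N (Q * (r + 1) - 1)) ^ l * N (Q * (r + 1)) ≤
          N (Q * (r + 1) + l) := by
        intro l
        induction l with
        | zero => simp
        | succ l ih =>
          have hle : N (Q * (r + 1)) / N (Q * (r + 1) - 1) ≤
              N (Q * (r + 1) + l + 1) / N (Q * (r + 1) + l) := by
            -- `Q = 0` is allowed here; the truncated subtraction then makes the quotient `N 0 / N 0
            -- = 1`.
            rcases Nat.eq_zero_or_pos (Q * (r + 1)) with h0 | h0
            · rw [h0]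
              simpa [hN.zero] using hN.one_le_ratio l
            · have := hN.ratio_mono (show Q * (r + 1) - 1 ≤ Q * (r + 1) + l by omega)
              simpa [Nat.sub_add_cancel h0] using this
          have h4 := hN.pos (Q * (r + 1) + l)
          have h5 := hN.pos (Q * (r + 1) - 1)
          calc _ = (N (Q * (r + 1)) / N (Q * (r + 1) - 1)) *
                ((N (Q * (r + 1)) / N (Q * (r + 1) - 1)) ^ l * N (Q * (r + 1))) := by ring
            _ ≤ (N (Q * (r + 1) + l + 1) / N (Q * (r + 1) + l)) * N (Q * (r + 1) + l) := by
                exact mul_le_mul hle ih (by positivity) ((div_pos (hN.pos _) h4).le)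
            _ = _ := div_mul_cancel₀ _ h4.ne'
      have hk := key Q
      have e : Q * (r + 1) + Q = Q * (r + 1 + 1) := by ring
      rw [e] at hk
      rw [div_le_div_iff₀ h3 h2]
      calc q ^ (Q * (r + 1 + 1)) * N (r + 1) ^ Q * N (Q * (r + 1))
          = q ^ (Q * (r + 1)) * N r ^ Q * ((q * (N (r + 1) / N r)) ^ Q * N (Q * (r + 1))) := by
            rw [← e, pow_add, mul_pow, div_pow]
            field_simp
        _ ≤ q ^ (Q * (r + 1)) * N r ^ Q *
            ((N (Q * (r + 1)) / N (Q * (r + 1) - 1)) ^ Q * N (Q * (r + 1))) := by gcongr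
        _ ≤ _ := by gcongr)
  refine ⟨C, fun r => ?_⟩
  have := hC ⟨r, rfl⟩
  exact (div_le_iff₀ (hN.pos _)).1 this

/-- For an index `Q(r+1) + s` with `s < Q`, `exists_pow_le` bounds the term at `qt` by a constant
times `(t · t · t^r / N_r)^Q`. One surplus `t` comes from the shift `r + 1`, the other from the
remainder `s`; each is absorbed by `t ≤ exp ω(t)`, which holds for `t ≥ 1` since `N_1 = 1`. This is
the origin of the factor `3Q`. -/
theorem IsNormalizedSeq.exists_weight_mul_le {N : ℕ → ℝ} (hN : IsNormalizedSeq N) {Q : ℕ}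
    (hQ : 0 < Q) {q : ℝ} (hq : 1 < q)
    (h : ∀ᶠ p in atTop, q * (N (p + 1) / N p) ≤ N (Q * (p + 1)) / N (Q * (p + 1) - 1)) {c : ℝ}
    (hc : 0 ≤ c) : ∃ (d : ℕ+) (C : ℝ), ∀ t, 0 ≤ t → assoWeight N (c * t) ≤ d * assoWeight N t + C := by
  obtain ⟨C₀, hC₀⟩ := hN.exists_pow_le hq h
  have hq0 : 0 < q := zero_lt_one.trans hq
  have one_le {t : ℝ} (ht : 1 ≤ t) : t ≤ Real.exp (assoWeight N t) := by
    simpa [hN.one] using hN.pow_div_le (zero_lt_one.trans_le ht) 1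
  have hC1 : 0 < C₀ := by
    have h1 := hC₀ 0
    have h2 := hN.pos 0
    have h3 := hN.pos (Q * (0 + 1))
    by_contra hneg
    have : 0 < q ^ (Q * (0 + 1)) * N 0 ^ Q := by positivity
    nlinarith [mul_nonneg (neg_nonneg.2 (not_lt.1 hneg)) h3.le]
  -- one dilation by `q`
  have step : ∃ C, ∀ t, 0 ≤ t →
      assoWeight N (q * t) ≤ ((3 * Q : ℕ) : ℝ) * assoWeight N t + C := by
    -- The entry 1 serves the indices `p < Q`, the entry `C₀` the others.
    set A : ℝ := q ^ Q * max 1 C₀ with hA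
    have hA0 : 0 < A := by positivity
    refine ⟨max (Real.log A) (assoWeight N q), fun t ht => ?_⟩
    rcases le_total t 1 with ht1 | ht1
    · have h1 := hN.weight_mono (by positivity) (show q * t ≤ q by nlinarith)
      have h2 := hN.nonneg ht
      have h3 : 0 ≤ ((3 * Q : ℕ) : ℝ) * assoWeight N t := by positivity
      linarith [le_max_right (Real.log A) (assoWeight N q)]
    · have ht0 : 0 < t := zero_lt_one.trans_le ht1
      suffices assoWeight N (q * t) ≤ ((3 * Q : ℕ) : ℝ) * assoWeight N t + Real.log A by
        linarith [le_max_left (Real.log A) (assoWeight N q)]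
      refine assoWeight_le_of_forall hN.pos (by positivity) fun p => ?_
      rw [Real.exp_add, Real.exp_log hA0, Real.exp_nat_mul]
      set E := Real.exp (assoWeight N t) with hE
      have hE1 : t ≤ E := one_le ht1
      have hqt : 1 ≤ q * t := by nlinarith
      have hE0 : 1 ≤ E := ht1.trans hE1
      obtain hpQ | hpQ := lt_or_ge p Q
      · calc (q * t) ^ p / N p ≤ (q * t) ^ p := by
              refine div_le_self (by positivity) ?_
              simpa [hN.zero] using hN.mono (Nat.zero_le p)
          _ ≤ (q * t) ^ Q := pow_le_pow_right₀ hqt hpQ.le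
          _ = t ^ Q * q ^ Q := by ring
          _ ≤ E ^ (3 * Q) * A := by
              have h1 : t ^ Q ≤ E ^ (3 * Q) :=
                (pow_le_pow_left₀ ht0.le hE1 Q).trans (pow_le_pow_right₀ hE0 (by omega))
              have h2 : q ^ Q ≤ A := le_mul_of_one_le_right (by positivity) (le_max_left _ _)
              gcongr
      · obtain ⟨r, s, hs, rfl⟩ : ∃ r s, s < Q ∧ p = Q * (r + 1) + s := by
          refine ⟨p / Q - 1, p % Q, Nat.mod_lt _ hQ, ?_⟩
          have : 1 ≤ p / Q := (Nat.one_le_div_iff hQ).2 hpQ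
          rw [Nat.sub_add_cancel this, Nat.div_add_mod]
        have h0 := hN.pos r
        have h2 := hN.pos (Q * (r + 1))
        have h3 := hN.pos (Q * (r + 1) + s)
        calc (q * t) ^ (Q * (r + 1) + s) / N (Q * (r + 1) + s)
            ≤ (q * t) ^ (Q * (r + 1) + s) / N (Q * (r + 1)) := by
              gcongr
              exact hN.mono (Nat.le_add_right _ _)
          _ = (q * t) ^ s * (q ^ (Q * (r + 1)) * t ^ (Q * (r + 1)) / N (Q * (r + 1))) := by
              rw [pow_add, mul_pow q t (Q * (r + 1))]
              ring
          _ ≤ (q * t) ^ Q * (C₀ * (t ^ (Q * (r + 1)) / N r ^ Q)) := by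
              refine mul_le_mul (pow_le_pow_right₀ hqt hs.le) ?_ (by positivity) (by positivity)
              rw [mul_div_assoc', div_le_div_iff₀ h2 (by positivity)]
              nlinarith [mul_le_mul_of_nonneg_left (hC₀ r)
                (show 0 ≤ t ^ (Q * (r + 1)) by positivity)]
          _ = (q ^ Q * C₀) * (t * t * (t ^ r / N r)) ^ Q := by
              rw [mul_pow, mul_pow, mul_pow, div_pow, Nat.mul_succ, pow_add, ← pow_mul,
                Nat.mul_comm r Q]
              ring
          _ ≤ A * (E * E * E) ^ Q := by
              have h4 : t ^ r / N r ≤ E := hN.pow_div_le ht0 r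
              have h5 : q ^ Q * C₀ ≤ A :=
                mul_le_mul_of_nonneg_left (le_max_right _ _) (by positivity)
              gcongr
          _ = _ := by
              rw [show E * E * E = E ^ 3 by ring, ← pow_mul, mul_comm]
  obtain ⟨C₁, hC₁⟩ := step
  -- iteration
  have iter (k : ℕ) : ∃ (d : ℕ) (C : ℝ), ∀ t, 0 ≤ t →
      assoWeight N (q ^ k * t) ≤ d * assoWeight N t + C := by
    induction k with
    | zero => exact ⟨1, 0, fun t _ => by simp⟩
    | succ k ih =>
      obtain ⟨d, C, hd⟩ := ih
      refine ⟨3 * Q * d, ((3 * Q : ℕ) : ℝ) * C + C₁, fun t ht => ?_⟩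
      have h1 := hC₁ (q ^ k * t) (by positivity)
      have h2 := mul_le_mul_of_nonneg_left (hd t ht) (show 0 ≤ ((3 * Q : ℕ) : ℝ) by positivity)
      rw [pow_succ', mul_assoc]
      push_cast at h1 h2 ⊢
      linarith
  obtain ⟨k, hk⟩ := pow_unbounded_of_one_lt c hq
  obtain ⟨d, C, hd⟩ := iter k
  -- The successor makes the multiplier positive; this is harmless since `ω ≥ 0`.
  refine ⟨d.succPNat, C, fun t ht => ?_⟩
  have h1 := hd t ht
  have h2 := hN.nonneg ht
  have h3 := hN.weight_mono (by positivity) (mul_le_mul_of_nonneg_right hk.le ht)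
  simp only [Nat.succPNat_coe, Nat.succ_eq_add_one, Nat.cast_add, Nat.cast_one]
  linarith

/-! ### The conjugate sequence -/

theorem LogConvex.mul_le {M : ℕ → ℝ} (hM : LogConvex M) (hpos : ∀ p, 0 < M p) (hM0 : M 0 = 1)
    (j k : ℕ) : M j * M k ≤ M (j + k) := by
  induction k with
  | zero => simp [hM0]
  | succ k ih =>
    have h1 := hpos k
    have h2 := hpos (j + k)
    have h3 := hpos j
    have h4 := hpos (k + 1)
    have hr : M (k + 1) / M k ≤ M (j + k + 1) / M (j + k) :=
      hM.ratio_mono hpos (Nat.le_add_left k j)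
    calc M j * M (k + 1) = (M (k + 1) / M k) * (M j * M k) := by field_simp
      _ ≤ (M (j + k + 1) / M (j + k)) * M (j + k) := by gcongr; exact (div_pos (hpos _) h2).le
      _ = _ := div_mul_cancel₀ _ h2.ne'

section Conjugate

variable {M : ℕ → ℝ} (hpos : ∀ p, 0 < M p)
include hpos

theorem conjugate_pos (p : ℕ) : 0 < conjugate M p :=
  div_pos (by positivity) (hpos p)

theorem isNormalizedSeq_conjugate (hM0 : M 0 = 1) (hM1 : M 1 = 1)
    (hlim : Tendsto (fun p : ℕ => reduced M p ^ (1 / (p : ℝ))) atTop (𝓝 0))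
    (hm : LogConcave (reduced M)) : IsNormalizedSeq (conjugate M) where
  pos := conjugate_pos hpos
  logConvex p := by
    have h := hm p
    have e (k : ℕ) : conjugate M k = (reduced M k)⁻¹ := (inv_div _ _).symm
    have hr (k : ℕ) : 0 < reduced M k := div_pos (hpos k) (by positivity)
    rw [e, e, e, ← mul_inv, inv_pow]
    exact inv_anti₀ (mul_pos (hr _) (hr _)) h
  zero := by simp [conjugate, hM0]
  one := by simp [conjugate, hM1]
  tendsto := by
    have hr (k : ℕ) : 0 < reduced M k := div_pos (hpos k) (by positivity)
    have h : Tendsto (fun p : ℕ => reduced M p ^ (1 / (p : ℝ))) atTop (𝓝[>] 0) :=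
      tendsto_nhdsWithin_iff.2 ⟨hlim, Eventually.of_forall fun p => Real.rpow_pos_of_pos (hr p) _⟩
    refine (tendsto_inv_nhdsGT_zero.comp h).congr fun p => ?_
    rw [Function.comp_apply, ← Real.inv_rpow (hr p).le, reduced, inv_div, conjugate]

/-- Combines `M_p^2 ≤ M_{2p}` with the bound `4^p` for the central binomial coefficient. -/
theorem conjugate_two_mul_le (hM : LogConvex M) (hM0 : M 0 = 1) (p : ℕ) :
    conjugate M (2 * p) ≤ 4 ^ p * conjugate M p ^ 2 := by
  have h1 := hM.mul_le hpos hM0 p p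
  have h2 : ((2 * p)! : ℝ) ≤ 4 ^ p * (p ! : ℝ) ^ 2 := by
    have h3 := Nat.choose_le_two_pow (2 * p) p
    have h4 := Nat.choose_mul_factorial_mul_factorial (show p ≤ 2 * p by omega)
    rw [show 2 * p - p = p by omega] at h4
    rw [pow_mul] at h3
    have h5 : (2 * p)! ≤ 4 ^ p * p ! ^ 2 := by
      rw [← h4, mul_assoc, ← sq]
      exact Nat.mul_le_mul_right _ h3
    exact_mod_cast h5
  have h6 := hpos p
  have h7 := hpos (2 * p)
  rw [← two_mul] at h1
  calc conjugate M (2 * p) ≤ (4 ^ p * (p ! : ℝ) ^ 2) / (M p * M p) := by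
        unfold conjugate
        gcongr
    _ = _ := by
        unfold conjugate
        rw [div_pow, sq (M p)]
        ring

/-- Since `ν_p = p / μ_p`, one has `ν_{Qp} / ν_p = Q μ_p / μ_{Qp}`. Any `b` strictly between `1/Q`
and the liminf gives `q = Q b > 1`. -/
theorem exists_conjugate_ratio_le
    (hQ : ∃ Q : ℕ, 2 ≤ Q ∧
      1 / (Q : ℝ) < liminf (fun p : ℕ => quotients M p / quotients M (Q * p)) atTop) :
    ∃ (Q : ℕ) (q : ℝ), 0 < Q ∧ 1 < q ∧ ∀ᶠ p in atTop,
      q * (conjugate M (p + 1) / conjugate M p) ≤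
        conjugate M (Q * (p + 1)) / conjugate M (Q * (p + 1) - 1) := by
  obtain ⟨Q, hQ2, hQ⟩ := hQ
  obtain ⟨b, hb1, hb2⟩ := exists_between hQ
  have hQ0 : 0 < (Q : ℝ) := by
    have : 0 < Q := by omega
    exact_mod_cast this
  have hquot (p : ℕ) : 0 < quotients M p := by
    cases p with
    | zero => exact one_pos
    | succ p => exact div_pos (hpos _) (hpos _)
  have hr (p : ℕ) : conjugate M (p + 1) / conjugate M p = (p + 1 : ℕ) / quotients M (p + 1) := by
    have h1 := (hpos p).ne'
    have h2 := (hpos (p + 1)).ne'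
    have h3 : (p ! : ℝ) ≠ 0 := by positivity
    rw [conjugate, conjugate, quotients, Nat.factorial_succ]
    push_cast
    field_simp
  refine ⟨Q, Q * b, by omega, ?_, ?_⟩
  · rw [div_lt_iff₀ hQ0] at hb1
    linarith
  · have hev := eventually_lt_of_lt_liminf hb2
      (isBoundedUnder_of ⟨0, fun p => (div_pos (hquot p) (hquot (Q * p))).le⟩)
    filter_upwards [(tendsto_add_atTop_nat 1).eventually hev] with p hp
    obtain ⟨k, hk⟩ : ∃ k, Q * (p + 1) = k + 1 :=
      Nat.exists_eq_succ_of_ne_zero (by positivity)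
    rw [hk] at hp ⊢
    rw [Nat.add_sub_cancel, hr, hr, mul_div_assoc', div_le_div_iff₀ (hquot _) (hquot _), ← hk]
    rw [lt_div_iff₀ (hquot _)] at hp
    push_cast
    have hp1 : (0 : ℝ) < p + 1 := by positivity
    have := mul_le_mul_of_nonneg_left hp.le (mul_pos hQ0 hp1).le
    rw [hk]
    linarith

end Conjugate

/-! ### Continuity of linear maps between inductive and projective limits -/

section Limits

variable {V V' H H' ι ι' κ κ' : Type*} [AddCommGroup V] [Module ℂ V] [AddCommGroup V'] [Module ℂ V']
  [NormedAddCommGroup H] [NormedSpace ℂ H] [NormedAddCommGroup H'] [NormedSpace ℂ H']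

theorem SupSpace.le_norm {T : ι → V →ₗ[ℂ] H} (f : SupSpace T) (i : ι) : ‖T i f.1‖ ≤ ‖f‖ :=
  le_ciSup f.2 i

theorem SupSpace.norm_le {T : ι → V →ₗ[ℂ] H} (f : SupSpace T) {A : ℝ} (hA : 0 ≤ A)
    (h : ∀ i, ‖T i f.1‖ ≤ A) : ‖f‖ ≤ A :=
  Real.iSup_le h hA

theorem mem_supSubmodule {T : ι → V →ₗ[ℂ] H} {f : V} {A : ℝ} (h : ∀ i, ‖T i f‖ ≤ A) :
    f ∈ supSubmodule T :=
  ⟨A, by rintro _ ⟨i, rfl⟩; exact h i⟩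

instance (T : κ → ι → V →ₗ[ℂ] H) : IsTopologicalAddGroup (IndLim T) :=
  topologicalAddGroup_sInf fun _ ht => ht.1

instance (T : κ → ι → V →ₗ[ℂ] H) : ContinuousSMul ℂ (IndLim T) :=
  continuousSMul_sInf fun _ ht => ht.2.1

instance (T : κ → ι → V →ₗ[ℂ] H) : LocallyConvexSpace ℝ (IndLim T) :=
  LocallyConvexSpace.sInf fun _ ht => ht.2.2.1

theorem IndLim.continuous_incl (T : κ → ι → V →ₗ[ℂ] H) (n : κ) : Continuous (IndLim.incl T n) :=
  continuous_sInf_rng.2 fun _ ht => ht.2.2.2 n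

/-- The universal property of the locally convex inductive limit. -/
theorem IndLim.continuous_of_comp_incl {T : κ → ι → V →ₗ[ℂ] H} {E : Type*} [AddCommGroup E]
    [Module ℂ E] [TopologicalSpace E] [IsTopologicalAddGroup E] [ContinuousSMul ℂ E]
    [LocallyConvexSpace ℝ E] (L : IndLim T →ₗ[ℂ] E)
    (h : ∀ n, Continuous fun f => L (IndLim.incl T n f)) : Continuous L := by
  -- The topology induced by `L` is one of those over which the infimum is taken.
  refine continuous_iff_le_induced.2 (sInf_le ⟨topologicalAddGroup_induced L,
    continuousSMul_induced L, LocallyConvexSpace.induced (L.restrictScalars ℝ),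
    fun n => continuous_induced_rng.2 (h n)⟩)

/-- Each restriction to a step factors through a bounded map into a single normed step of the
target, so the universal property applies. -/
theorem IndLim.continuous_of_bound {T : κ → ι → V →ₗ[ℂ] H} {T' : κ' → ι' → V' →ₗ[ℂ] H'}
    (L : IndLim T →ₗ[ℂ] IndLim T')
    (h : ∀ n, ∃ n' C, 0 ≤ C ∧
      ∀ (f : SupSpace (T n)) (j : ι'), ‖T' n' j (L (IndLim.incl T n f)).val‖ ≤ C * ‖f‖) :
    Continuous L := by
  refine IndLim.continuous_of_comp_incl L fun n => ?_
  obtain ⟨n', C, hC, hb⟩ := h n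
  let g : SupSpace (T n) →+ SupSpace (T' n') :=
    { toFun := fun f => ⟨(L (IndLim.incl T n f)).val, mem_supSubmodule (hb f)⟩
      map_zero' := by
        refine Subtype.ext ?_
        have : IndLim.incl T n 0 = 0 := rfl
        simp only [this, map_zero]
        rfl
      map_add' := fun f₁ f₂ => by
        refine Subtype.ext ?_
        have : IndLim.incl T n (f₁ + f₂) = IndLim.incl T n f₁ + IndLim.incl T n f₂ := rfl
        simp only [this, map_add]
        rfl }
  have hg : Continuous g := AddMonoidHomClass.continuous_of_bound g C fun f =>
    SupSpace.norm_le _ (mul_nonneg hC (norm_nonneg f)) (hb f)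
  exact (IndLim.continuous_incl T' n').comp hg

theorem ProjLim.continuous_proj (T : κ → ι → V →ₗ[ℂ] H) (n : κ) : Continuous (ProjLim.proj T n) :=
  continuous_iInf_dom (i := n) continuous_induced_dom

theorem ProjLim.continuous_of_bound {T : κ → ι → V →ₗ[ℂ] H} {T' : κ' → ι' → V' →ₗ[ℂ] H'}
    (L : ProjLim T →ₗ[ℂ] ProjLim T')
    (h : ∀ n', ∃ n C, 0 ≤ C ∧
      ∀ (f : ProjLim T) (j : ι'), ‖T' n' j (L f).val‖ ≤ C * ‖ProjLim.proj T n f‖) :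
    Continuous L := by
  refine continuous_iInf_rng.2 fun n' => continuous_induced_rng.2 ?_
  obtain ⟨n, C, hC, hb⟩ := h n'
  refine continuous_iff_continuousAt.2 fun f₀ => ?_
  rw [ContinuousAt, tendsto_iff_dist_tendsto_zero]
  have hlim : Tendsto (fun f => C * dist (ProjLim.proj T n f) (ProjLim.proj T n f₀)) (𝓝 f₀)
      (𝓝 0) := by
    have := tendsto_iff_dist_tendsto_zero.1 ((ProjLim.continuous_proj T n).tendsto f₀)
    simpa using this.const_mul C
  refine squeeze_zero (fun _ => dist_nonneg) (fun f => ?_) hlim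
  have e1 : ProjLim.proj T n f - ProjLim.proj T n f₀ = ProjLim.proj T n (f - f₀) := rfl
  have e2 : ProjLim.proj T' n' (L f) - ProjLim.proj T' n' (L f₀) =
      ProjLim.proj T' n' (L (f - f₀)) := by
    rw [map_sub]
    rfl
  rw [dist_eq_norm, dist_eq_norm, e1]
  change ‖ProjLim.proj T' n' (L f) - ProjLim.proj T' n' (L f₀)‖ ≤ _
  rw [e2]
  exact SupSpace.norm_le _ (mul_nonneg hC (norm_nonneg _)) (hb _)

/-- The sup-norm of the family `T'` is bounded by a multiple of the sup-norm of `T`. -/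
def Dominates (T : ι → V →ₗ[ℂ] H) (T' : ι' → V →ₗ[ℂ] H') : Prop :=
  ∃ C, 0 ≤ C ∧ ∀ f A, 0 ≤ A → (∀ i, ‖T i f‖ ≤ A) → ∀ j, ‖T' j f‖ ≤ C * A

theorem Dominates.supSubmodule_le {T : ι → V →ₗ[ℂ] H} {T' : ι' → V →ₗ[ℂ] H'}
    (h : Dominates T T') : supSubmodule T ≤ supSubmodule T' := by
  obtain ⟨C, hC, h⟩ := h
  intro f hf
  let g : SupSpace T := ⟨f, hf⟩
  exact mem_supSubmodule (h f _ (norm_nonneg g) (SupSpace.le_norm g))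

/-- Mutual domination makes the two families of norms cofinal in each other, so the unions agree and
the identity is continuous both ways. -/
theorem IndLim.exists_equiv {T : κ → ι → V →ₗ[ℂ] H} {T' : κ' → ι' → V →ₗ[ℂ] H'}
    (h : ∀ n, ∃ n', Dominates (T n) (T' n')) (h' : ∀ n', ∃ n, Dominates (T' n') (T n)) :
    ∃ e : IndLim T ≃L[ℂ] IndLim T', ∀ f, (e f).val = f.val := by
  have le : indSubmodule T ≤ indSubmodule T' := iSup_le fun n => by
    obtain ⟨n', hn⟩ := h n
    exact hn.supSubmodule_le.trans (le_iSup (fun n => supSubmodule (T' n)) n')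
  have le' : indSubmodule T' ≤ indSubmodule T := iSup_le fun n => by
    obtain ⟨n', hn⟩ := h' n
    exact hn.supSubmodule_le.trans (le_iSup (fun n => supSubmodule (T n)) n')
  let e₀ : IndLim T ≃ₗ[ℂ] IndLim T' := LinearEquiv.ofEq _ _ (le_antisymm le le')
  refine ⟨⟨e₀, ?_, ?_⟩, fun f => rfl⟩
  · refine IndLim.continuous_of_bound e₀.toLinearMap fun n => ?_
    obtain ⟨n', C, hC, hb⟩ := h n
    exact ⟨n', C, hC, fun f => hb f.1 _ (norm_nonneg f) (SupSpace.le_norm f)⟩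
  · refine IndLim.continuous_of_bound e₀.symm.toLinearMap fun n => ?_
    obtain ⟨n', C, hC, hb⟩ := h' n
    exact ⟨n', C, hC, fun f => hb f.1 _ (norm_nonneg f) (SupSpace.le_norm f)⟩

theorem ProjLim.exists_equiv {T : κ → ι → V →ₗ[ℂ] H} {T' : κ' → ι' → V →ₗ[ℂ] H'}
    (h : ∀ n', ∃ n, Dominates (T n) (T' n')) (h' : ∀ n, ∃ n', Dominates (T' n') (T n)) :
    ∃ e : ProjLim T ≃L[ℂ] ProjLim T', ∀ f, (e f).val = f.val := by
  have le : projSubmodule T ≤ projSubmodule T' := le_iInf fun n => by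
    obtain ⟨n', hn⟩ := h n
    exact (iInf_le (fun n => supSubmodule (T n)) n').trans hn.supSubmodule_le
  have le' : projSubmodule T' ≤ projSubmodule T := le_iInf fun n => by
    obtain ⟨n', hn⟩ := h' n
    exact (iInf_le (fun n => supSubmodule (T' n)) n').trans hn.supSubmodule_le
  let e₀ : ProjLim T ≃ₗ[ℂ] ProjLim T' := LinearEquiv.ofEq _ _ (le_antisymm le le')
  refine ⟨⟨e₀, ?_, ?_⟩, fun f => rfl⟩
  · refine ProjLim.continuous_of_bound e₀.toLinearMap fun n => ?_
    obtain ⟨n', C, hC, hb⟩ := h n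
    exact ⟨n', C, hC, fun f => hb f.1 _ (norm_nonneg _) (SupSpace.le_norm (ProjLim.proj T n' f))⟩
  · refine ProjLim.continuous_of_bound e₀.symm.toLinearMap fun n => ?_
    obtain ⟨n', C, hC, hb⟩ := h' n
    exact ⟨n', C, hC, fun f => hb f.1 _ (norm_nonneg _) (SupSpace.le_norm (ProjLim.proj T' n' f))⟩

end Limits

/-! ### Dilated and powered weights -/

section Weights

variable {H : Type*} [NormedAddCommGroup H] [NormedSpace ℂ H]

theorem norm_weightedEval {v : ℝ → ℝ} {z : ℂ} (hv : 0 ≤ v ‖z‖) (f : Entire H) :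
    ‖weightedEval v z f‖ = v ‖z‖ * ‖f.1 z‖ := by
  change ‖(v ‖z‖ : ℂ) • f.1 z‖ = _
  rw [norm_smul, Complex.norm_real, Real.norm_of_nonneg hv]

theorem dominates_weightedEval {v w : ℝ → ℝ} (hv : ∀ t, 0 ≤ v t) (hw : ∀ t, 0 ≤ w t) {C : ℝ}
    (hC : 0 ≤ C) (h : ∀ t, 0 ≤ t → w t ≤ C * v t) :
    Dominates (weightedEval (H := H) v) (weightedEval (H := H) w) := by
  refine ⟨C, hC, fun f A _ hf z => ?_⟩
  have h1 := hf z
  rw [norm_weightedEval (hv _)] at h1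
  rw [norm_weightedEval (hw _)]
  calc w ‖z‖ * ‖f.1 z‖ ≤ C * v ‖z‖ * ‖f.1 z‖ := by
        have := h _ (norm_nonneg z)
        gcongr
    _ ≤ C * A := by
        rw [mul_assoc]
        gcongr

theorem dilate_weight (N : ℕ → ℝ) (c t : ℝ) :
    dilate (weight N) c t = Real.exp (-assoWeight N (c * t)) := rfl

theorem power_weight (N : ℕ → ℝ) (c t : ℝ) :
    power (weight N) c t = Real.exp (-(c * assoWeight N t)) := by
  rw [power, weight, ← Real.exp_mul]
  congr 1
  ring

theorem dominates_of_le {v w a b : ℝ → ℝ} (hv : ∀ t, v t = Real.exp (-a t))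
    (hw : ∀ t, w t = Real.exp (-b t)) {C : ℝ} (h : ∀ t, 0 ≤ t → a t ≤ b t + C) :
    Dominates (weightedEval (H := H) v) (weightedEval (H := H) w) := by
  refine dominates_weightedEval (fun t => ?_) (fun t => ?_) (Real.exp_pos C).le fun t ht => ?_
  · rw [hv]
    positivity
  · rw [hw]
    positivity
  · rw [hv, hw, ← Real.exp_add, Real.exp_le_exp]
    linarith [h t ht]

variable {N : ℕ → ℝ}

theorem exists_holInd_equiv
    (h₁ : ∀ c : ℝ, 0 ≤ c → ∃ (d : ℕ+) (C : ℝ), ∀ t, 0 ≤ t →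
      assoWeight N (c * t) ≤ d * assoWeight N t + C)
    (h₂ : ∀ c : ℝ, ∃ d : ℕ+, ∀ t, 0 ≤ t → c * assoWeight N t ≤ assoWeight N (d * t)) :
    ∃ e : HolInd H (fun c => dilate (weight N) (c : ℝ)) ≃L[ℂ]
      HolInd H (fun c => power (weight N) (c : ℝ)), ∀ f, (e f).val = f.val := by
  refine IndLim.exists_equiv (fun n => ?_) fun n => ?_
  · obtain ⟨d, C, h⟩ := h₁ n (by positivity)
    exact ⟨d, dominates_of_le (dilate_weight N n) (power_weight N d) h⟩
  · obtain ⟨d, h⟩ := h₂ n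
    exact ⟨d, dominates_of_le (C := 0) (power_weight N n) (dilate_weight N d)
      fun t ht => by simpa using h t ht⟩

/-- The same two inequalities as for the inductive limits, evaluated at `t / d` and `t / n` and then
divided by the multiplier. -/
theorem exists_holProj_equiv
    (h₁ : ∀ c : ℝ, 0 ≤ c → ∃ (d : ℕ+) (C : ℝ), ∀ t, 0 ≤ t →
      assoWeight N (c * t) ≤ d * assoWeight N t + C)
    (h₂ : ∀ c : ℝ, ∃ d : ℕ+, ∀ t, 0 ≤ t → c * assoWeight N t ≤ assoWeight N (d * t)) :
    ∃ e : HolProj H (fun c => dilate (weight N) (1 / (c : ℝ))) ≃L[ℂ]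
      HolProj H (fun c => power (weight N) (1 / (c : ℝ))), ∀ f, (e f).val = f.val := by
  refine ProjLim.exists_equiv (fun n => ?_) fun n => ?_
  · have hn : (0 : ℝ) < (n : ℕ) := by exact_mod_cast n.pos
    obtain ⟨d, h⟩ := h₂ n
    have hd : (0 : ℝ) < (d : ℕ) := by exact_mod_cast d.pos
    refine ⟨d, dominates_of_le (C := 0) (dilate_weight N _) (power_weight N _) fun t ht => ?_⟩
    have := h (1 / d * t) (by positivity)
    rw [← mul_assoc, mul_one_div_cancel hd.ne', one_mul] at this
    rw [add_zero, one_div_mul_eq_div _ (assoWeight N t), le_div_iff₀ hn]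
    linarith
  · have hn : (0 : ℝ) < (n : ℕ) := by exact_mod_cast n.pos
    obtain ⟨d, C, h⟩ := h₁ n hn.le
    have hd : (0 : ℝ) < (d : ℕ) := by exact_mod_cast d.pos
    refine ⟨d, dominates_of_le (C := C / d) (power_weight N _) (dilate_weight N _) fun t ht => ?_⟩
    have := h (1 / n * t) (by positivity)
    rw [← mul_assoc, mul_one_div_cancel hn.ne', one_mul] at this
    rw [one_div_mul_eq_div _ (assoWeight N t), div_le_iff₀ hd, add_mul, div_mul_cancel₀ _ hd.ne']
    linarith

end Weights

/-! ### Entire functions and their restrictions to intervals -/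

section Restriction

variable {H : Type*} [NormedAddCommGroup H] [NormedSpace ℂ H] [CompleteSpace H]

theorem contDiff_comp_ofReal {F : ℂ → H} (hF : Differentiable ℂ F) :
    ContDiff ℝ ∞ fun x : ℝ => F x :=
  (hF.contDiff.restrict_scalars ℝ).comp Complex.ofRealCLM.contDiff

theorem iteratedDerivWithin_comp_ofReal {F : ℂ → H} (hF : Differentiable ℂ F) {S : Set ℝ}
    (hS : UniqueDiffOn ℝ S) (p : ℕ) {x : ℝ} (hx : x ∈ S) :
    iteratedDerivWithin p (fun x : ℝ => F x) S x = iteratedDeriv p F x := by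
  induction p generalizing x with
  | zero => simp
  | succ p ih =>
    rw [iteratedDerivWithin_succ, iteratedDeriv_succ,
      derivWithin_congr (fun y hy => ih hy) (ih hx)]
    have hd : DifferentiableAt ℂ (iteratedDeriv p F) (x : ℂ) :=
      (hF.contDiff (n := ∞)).differentiable_iteratedDeriv p (by exact_mod_cast WithTop.coe_lt_top _) _
    have h := hd.hasDerivAt.scomp x (Complex.ofRealCLM.hasDerivAt (x := x))
    simp only [Complex.ofRealCLM_apply, Complex.ofReal_one, one_smul] at h
    exact (h.hasDerivWithinAt (s := S)).derivWithin (hS x hx)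

omit [NormedSpace ℂ H] [CompleteSpace H] in
theorem zeroExt_ofEntire_eqOn (S : NondegInterval) (F : ℂ → H) :
    Set.EqOn (zeroExt S fun x => F (x : ℝ)) (fun x : ℝ => F x) S.carrier := by
  intro x hx
  simp [zeroExt, hx]

/-- The restriction of entire functions to an interval. -/
def ofEntire (S : NondegInterval) : Entire H →ₗ[ℂ] Smooth H S where
  toFun F := ⟨fun x => F.1 (x : ℝ),
    ((contDiff_comp_ofReal F.2).contDiffOn).congr (zeroExt_ofEntire_eqOn S F.1)⟩
  map_add' _ _ := rfl
  map_smul' _ _ := rfl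

theorem derivAt_ofEntire (S : NondegInterval) (F : Entire H) (p : ℕ) (x : S.carrier) :
    derivAt S p x (ofEntire S F) = iteratedDeriv p F.1 (x : ℝ) :=
  (iteratedDerivWithin_congr (zeroExt_ofEntire_eqOn S F.1) x.2).trans
    (iteratedDerivWithin_comp_ofReal F.2 S.uniqueDiffOn p x.2)

omit [CompleteSpace H] in
-- Lets derivatives be computed on a compact subinterval, where Taylor's theorem is available.
theorem derivAt_eq_iteratedDerivWithin {S : NondegInterval} (f : Smooth H S) (p : ℕ) {J : Set ℝ}
    (hJ : UniqueDiffOn ℝ J) (hJS : J ⊆ S.carrier) (x : S.carrier) (hx : (x : ℝ) ∈ J) :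
    derivAt S p x f = iteratedDerivWithin p (zeroExt S f.1) J x := by
  have hf : ContDiffOn ℝ ∞ (zeroExt S f.1) S.carrier := f.2
  change iteratedDerivWithin p (zeroExt S f.1) S.carrier x = _
  simp only [iteratedDerivWithin]
  rw [iteratedFDerivWithin_subset hJS hJ S.uniqueDiffOn
    (hf.of_le (by exact_mod_cast le_top)) hx]

theorem isTaylorExtension_ofEntire {S : NondegInterval} (x₀ : S.carrier) (F : Entire H) :
    IsTaylorExtension x₀ (ofEntire S F) F := by
  intro z
  convert Complex.hasSum_taylorSeries_of_entire F.2 ((x₀ : ℝ) : ℂ) z using 2 with k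
  rw [derivAt_ofEntire, smul_smul, div_eq_inv_mul]

omit [CompleteSpace H] in
theorem IsTaylorExtension.unique {S : NondegInterval} {x₀ : S.carrier} {f : Smooth H S}
    {F G : Entire H} (hF : IsTaylorExtension x₀ f F) (hG : IsTaylorExtension x₀ f G) : F = G :=
  Subtype.ext (funext fun z => (hF z).unique (hG z))

omit [CompleteSpace H] in
/-- A linear map given by Taylor extension. -/
theorem exists_linearMap_isTaylorExtension {S : NondegInterval} (x₀ : S.carrier)
    (W : Submodule ℂ (Smooth H S)) (U : Submodule ℂ (Entire H))
    (h : ∀ f ∈ W, ∃ F ∈ U, IsTaylorExtension x₀ f F) :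
    ∃ L : W →ₗ[ℂ] U, ∀ f, IsTaylorExtension x₀ f.1 (L f).1 := by
  choose! E hE hT using h
  refine ⟨{ toFun := fun f => ⟨E f.1, hE f.1 f.2⟩, map_add' := fun f g => ?_,
            map_smul' := fun c f => ?_ }, fun f => hT f.1 f.2⟩
  -- Linearity is forced by uniqueness of sums, whatever the choice of `E`.
  · refine Subtype.ext ((hT _ (f + g).2).unique fun z => ?_)
    have := (hT _ f.2 z).add (hT _ g.2 z)
    simp only [Submodule.coe_add, map_add, smul_add]
    exact this
  · refine Subtype.ext ((hT _ (c • f).2).unique fun z => ?_)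
    have := (hT _ f.2 z).const_smul c
    simp only [Submodule.coe_smul, map_smul, smul_comm _ c]
    exact this

end Restriction

/-! ### Estimates for derivatives and Taylor series -/

section Estimates

variable {H : Type*} [NormedAddCommGroup H] [NormedSpace ℂ H] [CompleteSpace H]
  {M : ℕ → ℝ} (hpos : ∀ p, 0 < M p) (hN : IsNormalizedSeq (conjugate M))
include hpos hN

/-- Cauchy estimates for entire functions of restricted growth. -/
theorem norm_iteratedDeriv_le {F : ℂ → H} (hF : Differentiable ℂ F) {c A R : ℝ} (hc : 0 < c)
    (hb : ∀ z, ‖F z‖ ≤ A * Real.exp (assoWeight (conjugate M) (c * ‖z‖))) {x : ℂ} (hx : ‖x‖ ≤ R)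
    (p : ℕ) :
    ‖iteratedDeriv p F x‖ ≤
      A * Real.exp (assoWeight (conjugate M) (2 * c * R)) * ((2 * c) ^ p * M p) := by
  set N := conjugate M with hNdef
  -- Cauchy's estimate is used with radius `t / (2c)`. At this `t`, `exp ω(t)` is at most `t^p /
  -- N_p`, so `t^p` cancels against the radius and `p! / N_p = M_p` remains. The factor 1/2 leaves
  -- room for the centre: `c‖z‖ ≤ t/2 + cR`.
  set t := N (p + 1) / N p with ht
  have ht0 : 0 < t := div_pos (hN.pos _) (hN.pos _)
  have hA : 0 ≤ A := nonneg_of_mul_nonneg_left ((norm_nonneg _).trans (hb 0)) (Real.exp_pos _)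
  have hR : 0 ≤ R := (norm_nonneg x).trans hx
  have hr : 0 < t / (2 * c) := by positivity
  have key : ∀ z ∈ Metric.sphere x (t / (2 * c)),
      ‖F z‖ ≤ A * (t ^ p / N p * Real.exp (assoWeight N (2 * c * R))) := by
    intro z hz
    refine (hb z).trans (mul_le_mul_of_nonneg_left ?_ hA)
    have hz' : ‖z‖ ≤ t / (2 * c) + R := by
      rw [mem_sphere_iff_norm] at hz
      calc ‖z‖ = ‖(z - x) + x‖ := by rw [sub_add_cancel]
        _ ≤ _ := (norm_add_le _ _).trans (by rw [hz]; gcongr)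
    have h1 : c * ‖z‖ ≤ t / 2 + c * R := by
      calc c * ‖z‖ ≤ c * (t / (2 * c) + R) := by gcongr
        _ = _ := by field_simp
    have h2 := hN.weight_mono (by positivity) h1
    have h3 := hN.weight_add_le (show 0 ≤ t / 2 by positivity) (show 0 ≤ c * R by positivity)
    rw [show 2 * (t / 2) = t by ring, ← mul_assoc] at h3
    calc _ ≤ Real.exp (assoWeight N t + assoWeight N (2 * c * R)) :=
          Real.exp_le_exp.2 (h2.trans h3)
      _ = Real.exp (assoWeight N t) * Real.exp (assoWeight N (2 * c * R)) := Real.exp_add _ _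
      _ ≤ _ := by
        have := hN.exp_weight_ratio_le p
        gcongr
  refine (Complex.norm_iteratedDeriv_le_of_forall_mem_sphere_norm_le p hr hF.diffContOnCl
    key).trans (le_of_eq ?_)
  have h1 := (hpos p).ne'
  have h2 : (p ! : ℝ) ≠ 0 := by positivity
  clear_value t
  rw [hNdef, conjugate, div_pow t]
  field_simp

/-- The left side is `(hw)^k / N_k`; enlarging the argument of `ω` by `b` buys the geometric factor
`b^{-k}`. -/
theorem pow_mul_div_factorial_le {h w : ℝ} (hh : 0 ≤ h) (hw : 0 ≤ w) {b : ℝ} (hb : 0 < b) (k : ℕ) :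
    w ^ k / (k ! : ℝ) * (h ^ k * M k) ≤
      (1 / b) ^ k * Real.exp (assoWeight (conjugate M) (b * (h * w))) := by
  have h1 := hN.pow_div_le' (show 0 ≤ b * (h * w) by positivity) k
  calc w ^ k / (k ! : ℝ) * (h ^ k * M k) = (1 / b) ^ k * ((b * (h * w)) ^ k / conjugate M k) := by
        rw [conjugate, mul_pow, mul_pow, div_pow]
        have h1 := (hpos k).ne'
        field_simp
        simp
    _ ≤ _ := by gcongr

theorem exists_entire_hasSum {a : ℕ → H} {A h : ℝ} (hh : 0 < h)
    (ha : ∀ k, ‖a k‖ ≤ A * (h ^ k * M k)) (x₀ : ℂ) :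
    ∃ F : Entire H, (∀ z, HasSum (fun k : ℕ => ((z - x₀) ^ k / (k ! : ℂ)) • a k) (F.1 z)) ∧
      ∀ z, ‖F.1 z‖ ≤ 2 * Real.exp (assoWeight (conjugate M) (4 * h * ‖x₀‖)) * A *
        Real.exp (assoWeight (conjugate M) (4 * h * ‖z‖)) := by
  set N := conjugate M with hNdef
  have hA : 0 ≤ A := by
    have h1 := (norm_nonneg _).trans (ha 0)
    exact nonneg_of_mul_nonneg_left h1 (mul_pos (by positivity) (hpos 0))
  -- The free `w` is used three times: as `‖z - x₀‖` for convergence, as the radius of a ball for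
  -- uniformity, and as `‖z‖ + ‖x₀‖` for growth.
  have hterm (z : ℂ) (w : ℝ) (hzw : ‖z - x₀‖ ≤ w) (k : ℕ) :
      ‖((z - x₀) ^ k / (k ! : ℂ)) • a k‖ ≤
        A * Real.exp (assoWeight N (2 * (h * w))) * (1 / 2) ^ k := by
    have hw := (norm_nonneg _).trans hzw
    rw [norm_smul, norm_div, norm_pow, Complex.norm_natCast]
    calc ‖z - x₀‖ ^ k / (k ! : ℝ) * ‖a k‖ ≤ w ^ k / (k ! : ℝ) * (A * (h ^ k * M k)) := by
          have := ha k
          gcongr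
      _ = A * (w ^ k / (k ! : ℝ) * (h ^ k * M k)) := by ring
      _ ≤ A * ((1 / 2) ^ k * Real.exp (assoWeight N (2 * (h * w)))) := by
          have := pow_mul_div_factorial_le hpos hN hh.le hw two_pos k
          gcongr
      _ = _ := by ring
  have hgeo (B : ℝ) : HasSum (fun k : ℕ => B * (1 / 2 : ℝ) ^ k) (B * 2) :=
    hasSum_geometric_two.mul_left B
  have hsum (z : ℂ) : Summable (fun k : ℕ => ((z - x₀) ^ k / (k ! : ℂ)) • a k) :=
    Summable.of_norm_bounded (hgeo _).summable (hterm z _ le_rfl)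
  refine ⟨⟨fun z => ∑' k, ((z - x₀) ^ k / (k ! : ℂ)) • a k, ?_⟩, fun z => (hsum z).hasSum, ?_⟩
  · intro z
    have hd : DifferentiableOn ℂ (fun z => ∑' k : ℕ, ((z - x₀) ^ k / (k ! : ℂ)) • a k)
        (Metric.ball x₀ (‖z - x₀‖ + 1)) := by
      refine Complex.differentiableOn_tsum_of_summable_norm (hgeo _).summable (fun k => ?_)
        Metric.isOpen_ball fun k y hy => hterm y (‖z - x₀‖ + 1) ?_ k
      · fun_prop
      · rw [mem_ball_iff_norm] at hy
        exact hy.le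
    refine hd.differentiableAt (Metric.isOpen_ball.mem_nhds ?_)
    rw [mem_ball_iff_norm]
    exact lt_add_one _
  · intro z
    have h1 := (hsum z).hasSum.norm_le_of_bounded (hgeo _) (hterm z (‖z‖ + ‖x₀‖) (norm_sub_le _ _))
    refine h1.trans ?_
    have h2 := hN.weight_add_le (show 0 ≤ 2 * h * ‖z‖ by positivity)
      (show 0 ≤ 2 * h * ‖x₀‖ by positivity)
    rw [show 2 * h * ‖z‖ + 2 * h * ‖x₀‖ = 2 * (h * (‖z‖ + ‖x₀‖)) by ring,
      show 2 * (2 * h * ‖z‖) = 4 * h * ‖z‖ by ring,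
      show 2 * (2 * h * ‖x₀‖) = 4 * h * ‖x₀‖ by ring] at h2
    have h3 := Real.exp_le_exp.2 h2
    rw [Real.exp_add] at h3
    nlinarith [mul_le_mul_of_nonneg_left h3 hA]

omit [CompleteSpace H] in
/-- The Taylor series at the left endpoint of a compact interval represents the function. -/
theorem eq_of_hasSum_taylor_left {S : NondegInterval} (f : Smooth H S) {a b : ℝ} (hab : a < b)
    (hS : Set.Icc a b ⊆ S.carrier) {A h : ℝ} (hh : 0 < h)
    (hf : ∀ p, ∀ x : S.carrier, (x : ℝ) ∈ Set.Icc a b → ‖derivAt S p x f‖ ≤ A * (h ^ p * M p))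
    (x : S.carrier) (hx : (x : ℝ) ∈ Set.Icc a b) {y : H}
    (hy : HasSum (fun k : ℕ => ((((x : ℝ) : ℂ) - (a : ℂ)) ^ k / (k ! : ℂ)) •
      derivAt S k ⟨a, hS (Set.left_mem_Icc.2 hab.le)⟩ f) y) : f.1 x = y := by
  have ha : a ∈ Set.Icc a b := Set.left_mem_Icc.2 hab.le
  have hud := uniqueDiffOn_Icc hab
  have hsm : ContDiffOn ℝ ∞ (zeroExt S f.1) S.carrier := f.2
  have hA : 0 ≤ A := by
    have h1 := (norm_nonneg _).trans (hf 0 ⟨a, hS ha⟩ ha)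
    exact nonneg_of_mul_nonneg_left h1 (mul_pos (by positivity) (hpos 0))
  have hw : 0 ≤ (x : ℝ) - a := sub_nonneg.2 hx.1
  set B := A * Real.exp (assoWeight (conjugate M) (4 * (h * ((x : ℝ) - a)))) with hB
  have hrem (n : ℕ) :
      ‖f.1 x - ∑ k ∈ Finset.range (n + 1), ((((x : ℝ) : ℂ) - (a : ℂ)) ^ k / (k ! : ℂ)) •
        derivAt S k ⟨a, hS ha⟩ f‖ ≤ B * (1 / 2) ^ (n + 1) := by
    have h1 := taylor_mean_remainder_bound (f := zeroExt S f.1) (n := n)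
      (C := A * (h ^ (n + 1) * M (n + 1))) hab.le
      ((hsm.mono hS).of_le (by exact_mod_cast le_top)) hx (fun y hy => by
        rw [← derivAt_eq_iteratedDerivWithin f (n + 1) hud hS ⟨y, hS hy⟩ hy]
        exact hf _ _ hy)
    rw [taylor_within_apply] at h1
    have e1 : zeroExt S f.1 x = f.1 x := by simp [zeroExt]
    have e2 (k : ℕ) : (((k ! : ℝ))⁻¹ * ((x : ℝ) - a) ^ k) •
        iteratedDerivWithin k (zeroExt S f.1) (Set.Icc a b) a =
        ((((x : ℝ) : ℂ) - (a : ℂ)) ^ k / (k ! : ℂ)) • derivAt S k ⟨a, hS ha⟩ f := by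
      rw [derivAt_eq_iteratedDerivWithin f k hud hS ⟨a, hS ha⟩ ha, ← Complex.coe_smul]
      congr 1
      push_cast
      ring
    simp only [e1, e2] at h1
    refine h1.trans ?_
    -- The remainder bound carries `n!` instead of `(n+1)!`. The lost factor `n + 1 ≤ 2^(n+1)` is
    -- paid out of `4^{-(n+1)}`, leaving `2^{-(n+1)}`.
    have h2 := pow_mul_div_factorial_le hpos hN hh.le hw four_pos (n + 1)
    have h3 : ((n + 1 : ℕ) : ℝ) ≤ 2 ^ (n + 1) := by exact_mod_cast Nat.lt_two_pow_self.le
    have h4 : ((n + 1 : ℕ) : ℝ) * ((((x : ℝ) - a) ^ (n + 1) / ((n + 1)! : ℝ)) *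
        (h ^ (n + 1) * M (n + 1))) ≤ 2 ^ (n + 1) * ((1 / 4) ^ (n + 1) *
          Real.exp (assoWeight (conjugate M) (4 * (h * ((x : ℝ) - a))))) := by
      have := hpos (n + 1)
      gcongr
    calc _ = A * (((n + 1 : ℕ) : ℝ) * ((((x : ℝ) - a) ^ (n + 1) / ((n + 1)! : ℝ)) *
        (h ^ (n + 1) * M (n + 1)))) := by
          rw [Nat.factorial_succ]
          push_cast
          field_simp
      _ ≤ _ := mul_le_mul_of_nonneg_left h4 hA
      _ = _ := by
          rw [hB, show (1 / 2 : ℝ) = 2 * (1 / 4) by norm_num, mul_pow]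
          ring
  have hlim : Tendsto (fun n : ℕ => B * (1 / 2 : ℝ) ^ (n + 1)) atTop (𝓝 0) := by
    have := ((tendsto_pow_atTop_nhds_zero_of_lt_one (r := (1 / 2 : ℝ)) (by norm_num)
      (by norm_num)).comp (tendsto_add_atTop_nat 1)).const_mul B
    simpa using this
  have h1 := tendsto_zero_iff_norm_tendsto_zero.2 (squeeze_zero (fun _ => norm_nonneg _) hrem hlim)
  have h2 := (hy.tendsto_sum_nat.comp (tendsto_add_atTop_nat 1)).const_sub (f.1 x)
  exact sub_eq_zero.1 (tendsto_nhds_unique h2 h1)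

/-- The remainder estimate is one-sided, so `f` is expanded at the left endpoint of a compact
interval containing `x` and `x₀`. The resulting entire `G` equals `f` there, hence has the same
Taylor coefficients at `x₀` as `f`, and `F = G`. -/
theorem ofEntire_eq_of_isTaylorExtension {S : NondegInterval} {x₀ : S.carrier} {f : Smooth H S}
    {F : Entire H} (hF : IsTaylorExtension x₀ f F)
    (hf : ∀ K : Set ℝ, IsCompact K → K ⊆ S.carrier → ∃ A h : ℝ, 0 < h ∧
      ∀ p, ∀ x : S.carrier, (x : ℝ) ∈ K → ‖derivAt S p x f‖ ≤ A * (h ^ p * M p)) :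
    ofEntire S F = f := by
  refine Subtype.ext (funext fun x => ?_)
  -- The extra point keeps `[a, b]` nondegenerate when `x = x₀`.
  obtain ⟨y, hy, hyx⟩ := S.nontrivial.exists_ne (x₀ : ℝ)
  set a := min (min (x : ℝ) x₀) y with ha_def
  set b := max (max (x : ℝ) x₀) y with hb_def
  have hab : a < b := by
    rcases lt_or_gt_of_ne hyx with h | h
    · exact ((min_le_right _ _).trans_lt h).trans_le ((le_max_right _ _).trans (le_max_left _ _))
    · exact (((min_le_left _ _).trans (min_le_right _ _)).trans_lt h).trans_le (le_max_right _ _)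
  have ha : a ∈ S.carrier := by
    rcases min_choice (min (x : ℝ) x₀) y with h | h <;> rw [ha_def, h]
    · rcases min_choice (x : ℝ) x₀ with h | h <;> rw [h]
      exacts [x.2, x₀.2]
    · exact hy
  have hb : b ∈ S.carrier := by
    rcases max_choice (max (x : ℝ) x₀) y with h | h <;> rw [hb_def, h]
    · rcases max_choice (x : ℝ) x₀ with h | h <;> rw [h]
      exacts [x.2, x₀.2]
    · exact hy
  have hx : (x : ℝ) ∈ Set.Icc a b :=
    ⟨(min_le_left _ _).trans (min_le_left _ _), (le_max_left _ _).trans (le_max_left _ _)⟩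
  have hx₀ : (x₀ : ℝ) ∈ Set.Icc a b :=
    ⟨(min_le_left _ _).trans (min_le_right _ _), (le_max_right _ _).trans (le_max_left _ _)⟩
  have hS : Set.Icc a b ⊆ S.carrier := S.ordConnected.out ha hb
  obtain ⟨A, h, hh, hbd⟩ := hf _ isCompact_Icc hS
  obtain ⟨G, hG, -⟩ := exists_entire_hasSum hpos hN hh
    (fun k => hbd k ⟨a, ha⟩ (Set.left_mem_Icc.2 hab.le)) (a : ℂ)
  have heq (u : S.carrier) (hu : (u : ℝ) ∈ Set.Icc a b) : f.1 u = G.1 (u : ℝ) :=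
    eq_of_hasSum_taylor_left hpos hN f hab hS hh hbd u hu (hG _)
  have hder (k : ℕ) : derivAt S k x₀ f = derivAt S k x₀ (ofEntire S G) := by
    have hud := uniqueDiffOn_Icc hab
    rw [derivAt_eq_iteratedDerivWithin f k hud hS x₀ hx₀,
      derivAt_eq_iteratedDerivWithin _ k hud hS x₀ hx₀]
    refine iteratedDerivWithin_congr (fun u hu => ?_) hx₀
    simp only [zeroExt, hS hu, dif_pos]
    exact heq ⟨u, hS hu⟩ hu
  have hFG : F = G := hF.unique fun z => by
    have := isTaylorExtension_ofEntire x₀ G z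
    simpa only [hder] using this
  rw [hFG]
  exact (heq x hx).symm

end Estimates

/-! ### Ultradifferentiable classes and weighted spaces of entire functions -/

section Comparison

theorem NondegInterval.exists_compactSubinterval {I : NondegInterval} (x₀ : I.carrier) :
    ∃ K : CompactSubinterval I, (x₀ : ℝ) ∈ K.carrier := by
  obtain ⟨y, hy, hne⟩ := I.nontrivial.exists_ne (x₀ : ℝ)
  exact ⟨{ carrier := Set.uIcc (x₀ : ℝ) y
           ordConnected := Set.ordConnected_uIcc
           nontrivial := ⟨x₀, Set.left_mem_uIcc, y, Set.right_mem_uIcc, hne.symm⟩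
           isCompact := isCompact_uIcc
           subset := I.ordConnected.uIcc_subset x₀.2 hy }, Set.left_mem_uIcc⟩

variable {H : Type*} [NormedAddCommGroup H] [NormedSpace ℂ H] {M : ℕ → ℝ} (hpos : ∀ p, 0 < M p)
include hpos

theorem norm_ultraEval_le_iff {S : NondegInterval} {K : Set ℝ} {h : ℝ} (hh : 0 < h)
    (i : ℕ × {x : S.carrier // (x : ℝ) ∈ K}) (f : Smooth H S) (A : ℝ) :
    ‖ultraEval M S K h i f‖ ≤ A ↔ ‖derivAt S i.1 i.2.1 f‖ ≤ A * (h ^ i.1 * M i.1) := by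
  have h1 : 0 < h ^ i.1 * M i.1 := mul_pos (pow_pos hh _) (hpos _)
  rw [ultraEval, LinearMap.smul_apply, norm_smul, Complex.norm_real, norm_inv,
    Real.norm_of_nonneg h1.le, inv_mul_le_iff₀ h1, mul_comm]

theorem exists_bound_of_mem_supSubmodule {S : NondegInterval} {K : Set ℝ} {h : ℝ} (hh : 0 < h)
    {f : Smooth H S} (hf : f ∈ supSubmodule (ultraEval M S K h)) :
    ∃ A, ∀ p, ∀ x : S.carrier, (x : ℝ) ∈ K → ‖derivAt S p x f‖ ≤ A * (h ^ p * M p) := by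
  obtain ⟨A, hA⟩ := hf
  exact ⟨A, fun p x hx => (norm_ultraEval_le_iff hpos hh (p, ⟨x, hx⟩) f A).1 (hA ⟨_, rfl⟩)⟩

variable [CompleteSpace H] (hN : IsNormalizedSeq (conjugate M))
include hN

theorem norm_weightedEval_taylor_le {S : NondegInterval} (x₀ : S.carrier) {K : Set ℝ}
    (hx₀ : (x₀ : ℝ) ∈ K) {h c : ℝ} (hh : 0 < h) (hc : 4 * h ≤ c) {f : Smooth H S} {A : ℝ}
    (hf : ∀ i, ‖ultraEval M S K h i f‖ ≤ A) {F : Entire H} (hF : IsTaylorExtension x₀ f F) (z : ℂ) :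
    ‖weightedEval (dilate (weight (conjugate M)) c) z F‖ ≤
      2 * Real.exp (assoWeight (conjugate M) (4 * h * ‖((x₀ : ℝ) : ℂ)‖)) * A := by
  obtain ⟨G, hG, hb⟩ := exists_entire_hasSum hpos hN hh
    (fun k => (norm_ultraEval_le_iff hpos hh (k, ⟨x₀, hx₀⟩) f A).1 (hf _)) ((x₀ : ℝ) : ℂ)
  obtain rfl : F = G := hF.unique hG
  rw [norm_weightedEval (by rw [dilate_weight]; positivity), dilate_weight, Real.exp_neg,
    inv_mul_le_iff₀ (Real.exp_pos _), mul_comm (Real.exp _)]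
  have hA : 0 ≤ A := (norm_nonneg _).trans (hf (0, ⟨x₀, hx₀⟩))
  refine (hb z).trans (mul_le_mul_of_nonneg_left (Real.exp_le_exp.2 ?_) (by positivity))
  exact hN.weight_mono (by positivity) (by gcongr)

theorem exists_entire_of_mem_supSubmodule {S : NondegInterval} (x₀ : S.carrier) {K : Set ℝ}
    (hx₀ : (x₀ : ℝ) ∈ K) {h c : ℝ} (hh : 0 < h) (hc : 4 * h ≤ c) {f : Smooth H S}
    (hf : f ∈ supSubmodule (ultraEval M S K h)) :
    ∃ F : Entire H, F ∈ supSubmodule (weightedEval (dilate (weight (conjugate M)) c)) ∧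
      IsTaylorExtension x₀ f F := by
  obtain ⟨A, hA⟩ := hf
  obtain ⟨G, hG, -⟩ := exists_entire_hasSum hpos hN hh
    (fun k => (norm_ultraEval_le_iff hpos hh (k, ⟨x₀, hx₀⟩) f A).1 (hA ⟨_, rfl⟩)) ((x₀ : ℝ) : ℂ)
  exact ⟨G, mem_supSubmodule
    (norm_weightedEval_taylor_le hpos hN x₀ hx₀ hh hc (fun i => hA ⟨i, rfl⟩) hG), hG⟩

theorem norm_ultraEval_ofEntire_le (S : NondegInterval) {K : Set ℝ} {R : ℝ}
    (hK : ∀ x ∈ K, ‖((x : ℝ) : ℂ)‖ ≤ R) {h c : ℝ} (hc : 0 < c) (hh : 2 * c ≤ h) {F : Entire H}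
    {A : ℝ} (hF : ∀ z, ‖weightedEval (dilate (weight (conjugate M)) c) z F‖ ≤ A)
    (i : ℕ × {x : S.carrier // (x : ℝ) ∈ K}) :
    ‖ultraEval M S K h i (ofEntire S F)‖ ≤
      Real.exp (assoWeight (conjugate M) (2 * c * R)) * A := by
  have hh0 : 0 < h := by linarith
  have hA : 0 ≤ A := (norm_nonneg _).trans (hF 0)
  rw [norm_ultraEval_le_iff hpos hh0, derivAt_ofEntire]
  refine (norm_iteratedDeriv_le hpos hN F.2 (A := A) hc (fun z => ?_) (hK _ i.2.2) i.1).trans ?_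
  · have := hF z
    rwa [norm_weightedEval (by rw [dilate_weight]; positivity), dilate_weight, Real.exp_neg,
      inv_mul_le_iff₀ (Real.exp_pos _), mul_comm (Real.exp _)] at this
  · rw [mul_comm A]
    have := hpos i.1
    gcongr

theorem ofEntire_mem_supSubmodule (S : NondegInterval) {K : Set ℝ} (hK : IsCompact K) {h c : ℝ}
    (hc : 0 < c) (hh : 2 * c ≤ h) {F : Entire H}
    (hF : F ∈ supSubmodule (weightedEval (dilate (weight (conjugate M)) c))) :
    ofEntire S F ∈ supSubmodule (ultraEval M S K h) := by
  obtain ⟨A, hA⟩ := hF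
  obtain ⟨R, hR⟩ := hK.isBounded.exists_norm_le
  exact mem_supSubmodule (norm_ultraEval_ofEntire_le hpos hN S (R := R)
    (fun x hx => by simpa using hR x hx) hc hh fun z => hA ⟨z, rfl⟩)

/-- The extension depends only on the restriction of `f` to one compact interval around `x₀`, hence
is continuous for the projective topology. Its inverse is restriction of entire functions,
continuous into the class on every compact subinterval by the Cauchy estimates. -/
theorem exists_roumieu_equiv (I : NondegInterval) (x₀ : I.carrier) :
    ∃ e : Roumieu H M I ≃L[ℂ] HolInd H (fun c => dilate (weight (conjugate M)) (c : ℝ)),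
      ∀ f, IsTaylorExtension x₀ f.val (e f).val := by
  set v : ℕ+ → ℝ → ℝ := fun c => dilate (weight (conjugate M)) (c : ℝ) with hv
  have hc0 (n : ℕ+) : (0 : ℝ) < (n : ℕ) := by exact_mod_cast n.pos
  obtain ⟨K, hxK⟩ := I.exists_compactSubinterval x₀
  have hex (h : {h : ℝ // 0 < h}) : ∃ n : ℕ+, 4 * h.1 ≤ (n : ℕ) := by
    obtain ⟨n, hn⟩ := exists_nat_ge (4 * h.1)
    exact ⟨n.succPNat, hn.trans (by simp)⟩
  have : Nonempty {h : ℝ // 0 < h} := ⟨⟨1, one_pos⟩⟩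
  obtain ⟨L, hL⟩ := exists_linearMap_isTaylorExtension (⟨x₀, hxK⟩ : K.carrier)
    (indSubmodule fun h : {h : ℝ // 0 < h} => ultraEval (H := H) M K.toNondegInterval K.carrier h)
    (indSubmodule fun n : ℕ+ => weightedEval (H := H) (v n)) (by
      intro f hf
      obtain ⟨h, hf⟩ := (mem_indSubmodule (supSubmodule_ultraEval_mono M _ _).directed_le).1 hf
      obtain ⟨n, hn⟩ := hex h
      obtain ⟨F, hF, hT⟩ := exists_entire_of_mem_supSubmodule hpos hN
        (⟨x₀, hxK⟩ : K.carrier) hxK h.2 hn hf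
      exact ⟨F, Submodule.mem_iSup_of_mem n hF, hT⟩)
  let L' : RoumieuCompact H M K.toNondegInterval →ₗ[ℂ] HolInd H v := L
  have hLc : Continuous L' := IndLim.continuous_of_bound L' fun h => by
    obtain ⟨n, hn⟩ := hex h
    exact ⟨n, _, by positivity, fun f z => norm_weightedEval_taylor_le hpos hN
      (⟨x₀, hxK⟩ : K.carrier) hxK h.2 hn (SupSpace.le_norm f) (hL (IndLim.incl _ h f)) z⟩
  have hT (f : Roumieu H M I) : IsTaylorExtension x₀ f.val (L' (Roumieu.restrict K f)).val := by
    intro z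
    have := hL (Roumieu.restrict K f) z
    simp only [Roumieu.restrict, derivAt_restrict] at this
    exact this
  have hmem : (indSubmodule fun n : ℕ+ => weightedEval (H := H) (v n)) ≤
      (roumieuSubmodule H M I).comap (ofEntire I) := iSup_le fun n F hF K hK _ =>
    ⟨⟨2 * (n : ℕ), mul_pos two_pos (hc0 n)⟩,
      ofEntire_mem_supSubmodule hpos hN I hK (hc0 n) le_rfl hF⟩
  let e₀ : Roumieu H M I ≃ₗ[ℂ] HolInd H v :=
    { toFun := fun f => L' (Roumieu.restrict K f)
      map_add' := fun f g => L'.map_add (Roumieu.restrict K f) (Roumieu.restrict K g)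
      map_smul' := fun c f => L'.map_smul c (Roumieu.restrict K f)
      invFun := fun F => ⟨ofEntire I F.1, hmem F.2⟩
      left_inv := fun f => Subtype.ext (ofEntire_eq_of_isTaylorExtension hpos hN (hT f)
        fun K hK hKI => by
          obtain ⟨h, hf⟩ := f.2 K hK hKI
          obtain ⟨A, hA⟩ := exists_bound_of_mem_supSubmodule hpos h.2 hf
          exact ⟨A, h, h.2, hA⟩)
      right_inv := fun F => Subtype.ext
        ((hT _).unique (isTaylorExtension_ofEntire x₀ F.1)) }
  refine ⟨⟨e₀, ?_, ?_⟩, hT⟩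
  · exact hLc.comp (continuous_iInf_dom (i := K) continuous_induced_dom)
  · refine continuous_iInf_rng.2 fun K' => continuous_induced_rng.2 ?_
    let R : HolInd H v →ₗ[ℂ] RoumieuCompact H M K'.toNondegInterval :=
      { toFun := fun F => Roumieu.restrict K' (e₀.symm F)
        map_add' := fun _ _ => rfl
        map_smul' := fun _ _ => rfl }
    obtain ⟨B, hB⟩ := K'.isCompact.isBounded.exists_norm_le
    exact IndLim.continuous_of_bound R fun n => ⟨⟨2 * (n : ℕ), mul_pos two_pos (hc0 n)⟩, _,
      (Real.exp_pos _).le, fun F i => norm_ultraEval_ofEntire_le hpos hN K'.toNondegInterval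
        (R := B) (fun x hx => by simpa using hB x hx) (hc0 n) le_rfl (SupSpace.le_norm F) i⟩

theorem exists_beurling_equiv (I : NondegInterval) (x₀ : I.carrier) :
    ∃ e : Beurling H M I ≃L[ℂ] HolProj H (fun c => dilate (weight (conjugate M)) (1 / (c : ℝ))),
      ∀ f, IsTaylorExtension x₀ f.val (e f).val := by
  set v : ℕ+ → ℝ → ℝ := fun c => dilate (weight (conjugate M)) (1 / (c : ℝ)) with hv
  have hc0 (n : ℕ+) : (0 : ℝ) < 1 / (n : ℕ) := one_div_pos.2 (by exact_mod_cast n.pos)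
  obtain ⟨K, hxK⟩ := I.exists_compactSubinterval x₀
  have hex (h : {h : ℝ // 0 < h}) : ∃ n : ℕ+, 2 * (1 / ((n : ℕ) : ℝ)) ≤ h := by
    obtain ⟨n, hn⟩ := exists_nat_one_div_lt (half_pos h.2)
    refine ⟨n.succPNat, ?_⟩
    simp only [Nat.succPNat_coe, Nat.succ_eq_add_one, Nat.cast_add, Nat.cast_one]
    linarith
  -- Chosen so that the growth `exp ω(4h‖z‖)` of the extension matches dilation by `1/n`.
  let r (n : ℕ+) : {h : ℝ // 0 < h} := ⟨1 / (n : ℕ) / 4, div_pos (hc0 n) four_pos⟩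
  have hr (n : ℕ+) : 4 * (r n).1 ≤ 1 / ((n : ℕ) : ℝ) := (mul_div_cancel₀ _ four_ne_zero).le
  obtain ⟨L, hL⟩ := exists_linearMap_isTaylorExtension (⟨x₀, hxK⟩ : K.carrier)
    (projSubmodule fun h : {h : ℝ // 0 < h} => ultraEval (H := H) M K.toNondegInterval K.carrier h)
    (projSubmodule fun n : ℕ+ => weightedEval (H := H) (v n)) (by
      intro f hf
      have key (n : ℕ+) := exists_entire_of_mem_supSubmodule hpos hN
        (⟨x₀, hxK⟩ : K.carrier) hxK (r n).2 (hr n) ((Submodule.mem_iInf _).1 hf (r n))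
      -- Each `n` produces its own extension; uniqueness identifies them all with the one for `n =
      -- 1`.
      obtain ⟨F, -, hT⟩ := key 1
      refine ⟨F, (Submodule.mem_iInf _).2 fun n => ?_, hT⟩
      obtain ⟨G, hG, hT'⟩ := key n
      rwa [hT.unique hT'])
  let L' : BeurlingCompact H M K.toNondegInterval →ₗ[ℂ] HolProj H v := L
  have hLc : Continuous L' := ProjLim.continuous_of_bound L' fun n =>
    ⟨r n, _, by positivity, fun f z => norm_weightedEval_taylor_le hpos hN
      (⟨x₀, hxK⟩ : K.carrier) hxK (r n).2 (hr n) (SupSpace.le_norm (ProjLim.proj _ (r n) f)) (hL f) z⟩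
  have hT (f : Beurling H M I) : IsTaylorExtension x₀ f.val (L' (Beurling.restrict K f)).val := by
    intro z
    have := hL (Beurling.restrict K f) z
    simp only [Beurling.restrict, derivAt_restrict] at this
    exact this
  have hmem : (projSubmodule fun n : ℕ+ => weightedEval (H := H) (v n)) ≤
      (beurlingSubmodule H M I).comap (ofEntire I) := fun F hF K hK _ h => by
    obtain ⟨n, hn⟩ := hex h
    exact ofEntire_mem_supSubmodule hpos hN I hK (hc0 n) hn ((Submodule.mem_iInf _).1 hF n)
  let e₀ : Beurling H M I ≃ₗ[ℂ] HolProj H v :=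
    { toFun := fun f => L' (Beurling.restrict K f)
      map_add' := fun f g => L'.map_add (Beurling.restrict K f) (Beurling.restrict K g)
      map_smul' := fun c f => L'.map_smul c (Beurling.restrict K f)
      invFun := fun F => ⟨ofEntire I F.1, hmem F.2⟩
      left_inv := fun f => Subtype.ext (ofEntire_eq_of_isTaylorExtension hpos hN (hT f)
        fun K hK hKI => by
          obtain ⟨A, hA⟩ := exists_bound_of_mem_supSubmodule hpos one_pos
            (f.2 K hK hKI ⟨1, one_pos⟩)
          exact ⟨A, 1, one_pos, hA⟩)
      right_inv := fun F => Subtype.ext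
        ((hT _).unique (isTaylorExtension_ofEntire x₀ F.1)) }
  refine ⟨⟨e₀, ?_, ?_⟩, hT⟩
  · exact hLc.comp (continuous_iInf_dom (i := K) continuous_induced_dom)
  · refine continuous_iInf_rng.2 fun K' => continuous_induced_rng.2 ?_
    let R : HolProj H v →ₗ[ℂ] BeurlingCompact H M K'.toNondegInterval :=
      { toFun := fun F => Beurling.restrict K' (e₀.symm F)
        map_add' := fun _ _ => rfl
        map_smul' := fun _ _ => rfl }
    obtain ⟨B, hB⟩ := K'.isCompact.isBounded.exists_norm_le
    refine ProjLim.continuous_of_bound R fun h => ?_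
    obtain ⟨n, hn⟩ := hex h
    exact ⟨n, _, (Real.exp_pos _).le, fun F i => norm_ultraEval_ofEntire_le hpos hN
      K'.toNondegInterval (R := B) (fun x hx => by simpa using hB x hx) (hc0 n) hn
      (SupSpace.le_norm (ProjLim.proj _ n F)) i⟩

end Comparison

end UltraEntire

theorem mainTheorem3 {H : Type*} [NormedAddCommGroup H] [InnerProductSpace ℂ H] [CompleteSpace H]
    (M : ℕ → ℝ) (hpos : ∀ p, 0 < M p)
    (hM : LogConvex M) (hM0 : M 0 = 1) (hM1 : M 1 = 1)
    (hlim : Tendsto (fun p : ℕ => reduced M p ^ (1 / (p : ℝ))) atTop (𝓝 0))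
    (hm : LogConcave (reduced M))
    (hQ : ∃ Q : ℕ, 2 ≤ Q ∧
      1 / (Q : ℝ) < liminf (fun p : ℕ => quotients M p / quotients M (Q * p)) atTop) :
    (∃ e : HolInd H (fun c => dilate (weight (conjugate M)) (c : ℝ)) ≃L[ℂ]
        HolInd H (fun c => power (weight (conjugate M)) (c : ℝ)),
      ∀ f, (e f).val = f.val) ∧
    (∃ e : HolProj H (fun c => dilate (weight (conjugate M)) (1 / (c : ℝ))) ≃L[ℂ]
        HolProj H (fun c => power (weight (conjugate M)) (1 / (c : ℝ))),
      ∀ f, (e f).val = f.val) ∧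
    ∀ (I : NondegInterval) (x₀ : I.carrier),
      (∃ e : Roumieu H M I ≃L[ℂ] HolInd H (fun c => power (weight (conjugate M)) (c : ℝ)),
        ∀ f, IsTaylorExtension x₀ f.val (e f).val) ∧
      (∃ e : Beurling H M I ≃L[ℂ]
          HolProj H (fun c => power (weight (conjugate M)) (1 / (c : ℝ))),
        ∀ f, IsTaylorExtension x₀ f.val (e f).val) := by
  have hN := isNormalizedSeq_conjugate hpos hM0 hM1 hlim hm
  obtain ⟨Q, q, hQ0, hq, hev⟩ := exists_conjugate_ratio_le hpos hQ
  have h₁ (c : ℝ) (hc : 0 ≤ c) := hN.exists_weight_mul_le hQ0 hq hev hc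
  have h₂ (c : ℝ) := hN.exists_mul_weight_le (conjugate_two_mul_le hpos hM hM0) c
  obtain ⟨e, he⟩ := exists_holInd_equiv (H := H) h₁ h₂
  obtain ⟨e', he'⟩ := exists_holProj_equiv (H := H) h₁ h₂
  refine ⟨⟨e, he⟩, ⟨e', he'⟩, fun I x₀ => ⟨?_, ?_⟩⟩
  · obtain ⟨r, hr⟩ := exists_roumieu_equiv (H := H) hpos hN I x₀
    refine ⟨r.trans e, fun f => ?_⟩
    rw [ContinuousLinearEquiv.trans_apply, he]
    exact hr f
  · obtain ⟨r, hr⟩ := exists_beurling_equiv (H := H) hpos hN I x₀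
    refine ⟨r.trans e', fun f => ?_⟩
    rw [ContinuousLinearEquiv.trans_apply, he']
    exact hr f
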